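/- Let $\mathsf{Eff}$ be the effective topos: an object is a set $|X|$ with a symmetric and transitive "non-standard equality" $[\cdot=_X\cdot]:|X|\times|X|\to\mathcal P(\mathbb N)$, a morphism is an equivalence class of non-standard functional relations, and formulas are interpreted by number realizability. For a set $S$ let $\nabla S$ be the constant object, $[x=_{\nabla S}y]=\mathbb N$ if $x=y$ and $\emptyset$ otherwise; $\nabla$ is a functor $\mathsf{Set}\to\mathsf{Eff}$. Let $\omega_1$ be the set of countable ordinals with its usual order $\preceq$, and let $\mathsf{succ}:\omega_1\to\omega_1$ be the successor map. A chain in a poset $L$ is a subset $C$ such that $x\le y$ or $y\le x$ for all $x,y\in C$ (possibly empty), and $L$ is chain-complete if every chain in it has a supremum. (1) In the internal language of $\mathsf{Eff}$ the following hold: $\nabla\omega_1$, ordered by $\nabla{\preceq}$, is a distributive lattice; it is chain-complete; the endomap $\nabla\mathsf{succ}$ is monotone ($x\le y\Rightarrow f(x)\le f(y)$) and progressive ($x\le f(x)$); and $\nabla\mathsf{succ}$ has no fixed point. (2) Dependent Choice is valid in $\mathsf{Eff}$, but the following two statements are not valid in $\mathsf{Eff}$ (they fail for $\nabla\omega_1$),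 and neither of them is provable in higher-order intuitionistic logic (intuitionistic type theory with product types, power types, a type of truth values and a type of natural numbers, with comprehension, extensionality and the Peano axioms), even if Dependent Choice is added as an axiom at every type: (a) (Tarski's theorem for chain-complete lattices) a monotone map on a chain-complete lattice has a fixed point; (b) (Bourbaki–Witt) a progressive map on a chain-complete poset has a fixed point above every point. -/

import Mathlib

open CategoryTheory

/-! ## Realizability: non-standard predicates

Propositions are sets of realizers (codes of programs). -/

namespace Realizability

/-- The `n`-th partial recursive function, applied to `m`. -/
def app (n m : ℕ) : Part ℕ := (Denumerable.ofNat Nat.Partrec.Code n).eval m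

def rand (A B : Set ℕ) : Set ℕ := {k | ∃ m ∈ A, ∃ n ∈ B, k = Nat.pair m n}

def ror (A B : Set ℕ) : Set ℕ :=
  {k | (∃ n ∈ A, k = Nat.pair 0 n) ∨ (∃ n ∈ B, k = Nat.pair 1 n)}

def rimp (A B : Set ℕ) : Set ℕ := {n | ∀ m ∈ A, ∃ k ∈ app n m, k ∈ B}

/-- Validity of a non-standard predicate: one number realizes all instances. -/
def Valid {I : Type} (A : I → Set ℕ) : Prop := ∃ n, ∀ i, n ∈ A i

/-- The order of the Heyting prealgebra of non-standard predicates on `I`: a single program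
translates realizers of `A i` to realizers of `B i`, uniformly in `i`. -/
def Ent {I : Type} (A B : I → Set ℕ) : Prop := Valid fun i => rimp (A i) (B i)

/-! ### Basic rules, needed to construct the effective topos -/

theorem Ent.of_partrec {I : Type} {A B : I → Set ℕ} (f : ℕ →. ℕ) (hf : Nat.Partrec f)
    (h : ∀ i, ∀ m ∈ A i, ∃ k ∈ f m, k ∈ B i) : Ent A B := by
  obtain ⟨c, rfl⟩ := Nat.Partrec.Code.exists_code.1 hf
  refine ⟨Encodable.encode c, fun i m hm => ?_⟩
  simpa [app] using h i m hm

theorem Ent.partrec {I : Type} {A B : I → Set ℕ} (h : Ent A B) :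
    ∃ f : ℕ →. ℕ, Nat.Partrec f ∧ ∀ i, ∀ m ∈ A i, ∃ k ∈ f m, k ∈ B i := by
  obtain ⟨n, hn⟩ := h
  exact ⟨app n, Nat.Partrec.Code.exists_code.2 ⟨_, rfl⟩, hn⟩

theorem Ent.of_subset {I : Type} {A B : I → Set ℕ} (h : ∀ i, A i ⊆ B i) : Ent A B :=
  Ent.of_partrec _ Nat.Partrec.some fun i m hm => ⟨m, Part.mem_some m, h i hm⟩

theorem Ent.refl {I : Type} (A : I → Set ℕ) : Ent A A := Ent.of_subset fun _ => le_rfl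

theorem Ent.trans {I : Type} {A B C : I → Set ℕ} (h : Ent A B) (h' : Ent B C) : Ent A C := by
  obtain ⟨f, hf, hf'⟩ := h.partrec
  obtain ⟨g, hg, hg'⟩ := h'.partrec
  refine Ent.of_partrec _ (hg.comp hf) fun i m hm => ?_
  obtain ⟨k, hk, hkB⟩ := hf' i m hm
  obtain ⟨l, hl, hlC⟩ := hg' i k hkB
  exact ⟨l, Part.mem_bind_iff.2 ⟨k, hk, hl⟩, hlC⟩

theorem Ent.reindex {I J : Type} {A B : I → Set ℕ} (h : Ent A B) (f : J → I) :
    Ent (fun j => A (f j)) (fun j => B (f j)) :=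
  let ⟨n, hn⟩ := h
  ⟨n, fun j => hn (f j)⟩

theorem Ent.and_intro {I : Type} {A B C : I → Set ℕ} (h : Ent C A) (h' : Ent C B) :
    Ent C (fun i => rand (A i) (B i)) := by
  obtain ⟨f, hf, hf'⟩ := h.partrec
  obtain ⟨g, hg, hg'⟩ := h'.partrec
  refine Ent.of_partrec _ (hf.pair hg) fun i m hm => ?_
  obtain ⟨k, hk, hkB⟩ := hf' i m hm
  obtain ⟨l, hl, hlC⟩ := hg' i m hm
  refine ⟨Nat.pair k l, ?_, k, hkB, l, hlC, rfl⟩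
  simp only [Seq.seq, Part.map_eq_map, Part.mem_bind_iff, Part.mem_map_iff]
  exact ⟨_, ⟨k, hk, rfl⟩, l, hl, rfl⟩

theorem Ent.and_left' {I : Type} (A B : I → Set ℕ) : Ent (fun i => rand (A i) (B i)) A :=
  Ent.of_partrec _ Nat.Partrec.left fun i m hm => by
    obtain ⟨a, ha, b, hb, rfl⟩ := hm
    exact ⟨a, by simp, ha⟩

theorem Ent.and_right' {I : Type} (A B : I → Set ℕ) : Ent (fun i => rand (A i) (B i)) B :=
  Ent.of_partrec _ Nat.Partrec.right fun i m hm => by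
    obtain ⟨a, ha, b, hb, rfl⟩ := hm
    exact ⟨b, by simp, hb⟩

theorem Ent.left {I : Type} {A B C : I → Set ℕ} (h : Ent C (fun i => rand (A i) (B i))) :
    Ent C A := h.trans (Ent.and_left' A B)

theorem Ent.right {I : Type} {A B C : I → Set ℕ} (h : Ent C (fun i => rand (A i) (B i))) :
    Ent C B := h.trans (Ent.and_right' A B)

theorem Ent.imp_intro {I : Type} {A B C : I → Set ℕ}
    (h : Ent (fun i => rand (C i) (A i)) B) : Ent C (fun i => rimp (A i) (B i)) := by
  obtain ⟨f, hf, hf'⟩ := h.partrec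
  obtain ⟨c, rfl⟩ := Nat.Partrec.Code.exists_code.1 hf
  have hp : Computable fun n : ℕ => Encodable.encode (Nat.Partrec.Code.curry c n) :=
    (Computable.encode.comp
      (Nat.Partrec.Code.primrec₂_curry.to_comp.comp (Computable.const c) Computable.id))
  refine Ent.of_partrec _ (Partrec.nat_iff.1 hp) fun i m hm => ?_
  refine ⟨_, Part.mem_some _, fun a ha => ?_⟩
  simpa [app, Nat.Partrec.Code.eval_curry] using hf' i (Nat.pair m a) ⟨m, hm, a, ha, rfl⟩

theorem Ent.mp {I : Type} {A B C : I → Set ℕ} (h : Ent C (fun i => rimp (A i) (B i)))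
    (h' : Ent C A) : Ent C B := by
  refine (h.and_intro h').trans ?_
  have hp : Partrec fun n : ℕ => app n.unpair.1 n.unpair.2 :=
    Nat.Partrec.Code.eval_part.comp
      ((Computable.ofNat Nat.Partrec.Code).comp (Computable.fst.comp Computable.unpair))
      (Computable.snd.comp Computable.unpair)
  refine Ent.of_partrec _ (Partrec.nat_iff.1 hp) fun i m hm => ?_
  obtain ⟨a, ha, b, hb, rfl⟩ := hm
  simpa using ha b hb

theorem Ent.ex_elim {I J : Type} {C D : I → Set ℕ} {P : I → J → Set ℕ}
    (h : Ent C (fun i => ⋃ j, P i j))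
    (h' : Ent (fun p : I × J => rand (C p.1) (P p.1 p.2)) (fun p => D p.1)) : Ent C D := by
  refine ((Ent.refl C).and_intro h).trans ?_
  obtain ⟨n, hn⟩ := h'
  refine ⟨n, fun i m hm => ?_⟩
  obtain ⟨a, ha, b, hb, rfl⟩ := hm
  obtain ⟨j, hj⟩ := Set.mem_iUnion.1 hb
  exact hn (i, j) _ ⟨a, ha, b, hj, rfl⟩

theorem Ent.ex_intro {I J : Type} {C : I → Set ℕ} {P : I → J → Set ℕ} (f : I → J)
    (h : Ent C (fun i => P i (f i))) : Ent C (fun i => ⋃ j, P i j) :=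
  h.trans (Ent.of_subset fun i => Set.subset_iUnion (P i) (f i))

theorem Ent.all_intro {I J : Type} {C : I → Set ℕ} {P : I → J → Set ℕ}
    (h : Ent (fun p : I × J => C p.1) (fun p => P p.1 p.2)) : Ent C (fun i => ⋂ j, P i j) := by
  rcases isEmpty_or_nonempty J with hJ | ⟨⟨j₀⟩⟩
  · exact Ent.of_partrec _ Nat.Partrec.some fun i m _ => ⟨m, Part.mem_some m, by simp⟩
  · obtain ⟨n, hn⟩ := h
    refine ⟨n, fun i m hm => ?_⟩
    obtain ⟨k, hk, _⟩ := hn (i, j₀) m hm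
    refine ⟨k, hk, Set.mem_iInter.2 fun j => ?_⟩
    obtain ⟨l, hl, hl'⟩ := hn (i, j) m hm
    exact Part.mem_unique hl hk ▸ hl'

theorem Ent.all_mp {I J : Type} {C : I → Set ℕ} {P Q : I → J → Set ℕ}
    (h : Ent C (fun i => ⋂ j, rimp (P i j) (Q i j))) (f : I → J)
    (h' : Ent C (fun i => P i (f i))) : Ent C (fun i => Q i (f i)) :=
  (h.trans (Ent.of_subset fun i => Set.iInter_subset (fun j => rimp (P i j) (Q i j)) (f i))).mp h'

theorem Ent.with_hyp {I : Type} {C D : I → Set ℕ} (h : Ent C C → Ent C D) : Ent C D :=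
  h (Ent.refl C)

end Realizability

open Realizability

/-! ## The effective topos -/

/-- An object of the effective topos: a set with a symmetric and transitive non-standard
equality predicate. -/
structure Eff where
  carrier : Type
  eq : carrier → carrier → Set ℕ
  symm : Ent (fun p : carrier × carrier => eq p.1 p.2) (fun p => eq p.2 p.1)
  trans : Ent (fun p : carrier × carrier × carrier => rand (eq p.1 p.2.1) (eq p.2.1 p.2.2))
    (fun p => eq p.1 p.2.2)

namespace Eff

/-- The existence predicate. -/
def ex (X : Eff) (x : X.carrier) : Set ℕ := X.eq x x

theorem eq_symm (X : Eff) {I : Type} {C : I → Set ℕ} {f g : I → X.carrier}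
    (h : Ent C (fun i => X.eq (f i) (g i))) : Ent C (fun i => X.eq (g i) (f i)) :=
  h.trans (X.symm.reindex fun i => (f i, g i))

theorem eq_trans (X : Eff) {I : Type} {C : I → Set ℕ} {f g k : I → X.carrier}
    (h : Ent C (fun i => X.eq (f i) (g i))) (h' : Ent C (fun i => X.eq (g i) (k i))) :
    Ent C (fun i => X.eq (f i) (k i)) :=
  (h.and_intro h').trans (X.trans.reindex fun i => (f i, g i, k i))

theorem ex_left (X : Eff) {I : Type} {C : I → Set ℕ} {f g : I → X.carrier}
    (h : Ent C (fun i => X.eq (f i) (g i))) : Ent C (fun i => X.ex (f i)) :=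
  X.eq_trans h (X.eq_symm h)

theorem ex_right (X : Eff) {I : Type} {C : I → Set ℕ} {f g : I → X.carrier}
    (h : Ent C (fun i => X.eq (f i) (g i))) : Ent C (fun i => X.ex (g i)) :=
  X.eq_trans (X.eq_symm h) h

/-- Strict extensional predicates; they represent the subobjects of `X`. -/
structure StrictPred (X : Eff) where
  pred : X.carrier → Set ℕ
  strict : Ent pred X.ex
  ext : Ent (fun p : X.carrier × X.carrier => rand (pred p.1) (X.eq p.1 p.2))
    (fun p => pred p.2)

/-- Non-standard functional relations; they represent the morphisms `X ⟶ Y`. -/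
structure FunRel (X Y : Eff) where
  rel : X.carrier → Y.carrier → Set ℕ
  strict : Ent (fun p : X.carrier × Y.carrier => rel p.1 p.2)
    (fun p => rand (X.ex p.1) (Y.ex p.2))
  ext : Ent (fun p : X.carrier × X.carrier × Y.carrier × Y.carrier =>
      rand (X.eq p.1 p.2.1) (rand (rel p.2.1 p.2.2.1) (Y.eq p.2.2.1 p.2.2.2)))
    (fun p => rel p.1 p.2.2.2)
  single : Ent (fun p : X.carrier × Y.carrier × Y.carrier =>
      rand (rel p.1 p.2.1) (rel p.1 p.2.2))
    (fun p => Y.eq p.2.1 p.2.2)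
  total : Ent X.ex (fun x => ⋃ y, rand (Y.ex y) (rel x y))

namespace FunRel

variable {X Y Z W : Eff}

def Le (F G : FunRel X Y) : Prop :=
  Ent (fun p : X.carrier × Y.carrier => F.rel p.1 p.2) (fun p => G.rel p.1 p.2)

/-- Two functional relations represent the same morphism when they entail each other. -/
instance setoid (X Y : Eff) : Setoid (FunRel X Y) where
  r F G := F.Le G ∧ G.Le F
  iseqv := ⟨fun _ => ⟨Ent.refl _, Ent.refl _⟩, fun h => ⟨h.2, h.1⟩,
    fun h h' => ⟨Ent.trans h.1 h'.1, Ent.trans h'.2 h.2⟩⟩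

theorem exX (F : FunRel X Y) {I : Type} {C : I → Set ℕ} {x : I → X.carrier} {y : I → Y.carrier}
    (h : Ent C (fun i => F.rel (x i) (y i))) : Ent C (fun i => X.ex (x i)) :=
  (h.trans (F.strict.reindex fun i => (x i, y i))).left

theorem exY (F : FunRel X Y) {I : Type} {C : I → Set ℕ} {x : I → X.carrier} {y : I → Y.carrier}
    (h : Ent C (fun i => F.rel (x i) (y i))) : Ent C (fun i => Y.ex (y i)) :=
  (h.trans (F.strict.reindex fun i => (x i, y i))).right

theorem substX (F : FunRel X Y) {I : Type} {C : I → Set ℕ} {x x' : I → X.carrier}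
    {y : I → Y.carrier} (h : Ent C (fun i => X.eq (x' i) (x i)))
    (h' : Ent C (fun i => F.rel (x i) (y i))) : Ent C (fun i => F.rel (x' i) (y i)) :=
  (h.and_intro (h'.and_intro (F.exY h'))).trans (F.ext.reindex fun i => (x' i, x i, y i, y i))

theorem substY (F : FunRel X Y) {I : Type} {C : I → Set ℕ} {x : I → X.carrier}
    {y y' : I → Y.carrier} (h' : Ent C (fun i => F.rel (x i) (y i)))
    (h : Ent C (fun i => Y.eq (y i) (y' i))) : Ent C (fun i => F.rel (x i) (y' i)) :=
  ((F.exX h').and_intro (h'.and_intro h)).trans (F.ext.reindex fun i => (x i, x i, y i, y' i))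

theorem eqY (F : FunRel X Y) {I : Type} {C : I → Set ℕ} {x : I → X.carrier}
    {y y' : I → Y.carrier} (h : Ent C (fun i => F.rel (x i) (y i)))
    (h' : Ent C (fun i => F.rel (x i) (y' i))) : Ent C (fun i => Y.eq (y i) (y' i)) :=
  (h.and_intro h').trans (F.single.reindex fun i => (x i, y i, y' i))

theorem le_app {F G : FunRel X Y} (hFG : F.Le G) {I : Type} {C : I → Set ℕ}
    {x : I → X.carrier} {y : I → Y.carrier}
    (h : Ent C (fun i => F.rel (x i) (y i))) : Ent C (fun i => G.rel (x i) (y i)) :=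
  h.trans (Ent.reindex hFG fun i => (x i, y i))

/-- The identity is represented by equality. -/
def id (X : Eff) : FunRel X X where
  rel := X.eq
  strict := (X.ex_left (Ent.refl _)).and_intro (X.ex_right (Ent.refl _))
  ext := X.eq_trans (Ent.refl _).left (X.eq_trans (Ent.refl _).right.left (Ent.refl _).right.right)
  single := X.eq_trans (X.eq_symm (Ent.refl _).left) (Ent.refl _).right
  total := Ent.ex_intro (fun x => x) ((Ent.refl _).and_intro (Ent.refl _))

/-- Composition of functional relations. -/
def comp (F : FunRel X Y) (G : FunRel Y Z) : FunRel X Z where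
  rel x z := ⋃ y, rand (F.rel x y) (G.rel y z)
  strict := Ent.ex_elim (Ent.refl _)
    ((F.exX (Ent.refl _).right.left).and_intro (G.exY (Ent.refl _).right.right))
  ext := by
    refine Ent.ex_elim (Ent.refl _).right.left ?_
    refine Ent.ex_intro (fun p => p.2) ?_
    exact (F.substX (Ent.refl _).left.left (Ent.refl _).right.left).and_intro
      (G.substY (Ent.refl _).right.right (Ent.refl _).left.right.right)
  single := Ent.ex_elim (Ent.refl _).left (Ent.ex_elim (Ent.refl _).left.right
    (G.eqY
      (G.substX (F.eqY (Ent.refl _).right.left (Ent.refl _).left.right.left)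
        (Ent.refl _).left.right.right)
      (Ent.refl _).right.right))
  total := by
    refine Ent.ex_elim F.total ?_
    refine Ent.ex_elim (Ent.with_hyp fun h =>
      h.right.left.trans (G.total.reindex fun p : X.carrier × Y.carrier => p.2)) ?_
    refine Ent.ex_intro (fun p => p.2) ((Ent.refl _).right.left.and_intro ?_)
    refine Ent.ex_intro (fun p => p.1.2) ?_
    exact (Ent.refl _).left.right.right.and_intro (Ent.refl _).right.right

theorem comp_le {F F' : FunRel X Y} {G G' : FunRel Y Z} (h : F.Le F') (h' : G.Le G') :
    (F.comp G).Le (F'.comp G') := by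
  refine Ent.ex_elim (Ent.refl _) ?_
  refine Ent.ex_intro (fun p => p.2) ?_
  exact (le_app h (Ent.refl _).right.left).and_intro (le_app h' (Ent.refl _).right.right)

theorem id_comp (F : FunRel X Y) : (id X).comp F ≈ F := by
  constructor
  · exact Ent.ex_elim (Ent.refl _) (F.substX (Ent.refl _).right.left (Ent.refl _).right.right)
  · refine Ent.ex_intro (fun p => p.1) ?_
    exact (F.exX (Ent.refl _)).and_intro (Ent.refl _)

theorem comp_id (F : FunRel X Y) : F.comp (id Y) ≈ F := by
  constructor
  · exact Ent.ex_elim (Ent.refl _) (F.substY (Ent.refl _).right.left (Ent.refl _).right.right)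
  · refine Ent.ex_intro (fun p => p.2) ?_
    exact (Ent.refl _).and_intro (F.exY (Ent.refl _))

theorem assoc (F : FunRel X Y) (G : FunRel Y Z) (H : FunRel Z W) :
    (F.comp G).comp H ≈ F.comp (G.comp H) := by
  constructor
  · refine Ent.ex_elim (Ent.refl _) ?_
    refine Ent.ex_elim (Ent.refl _).right.left ?_
    refine Ent.ex_intro (fun p => p.2) ((Ent.refl _).right.left.and_intro ?_)
    refine Ent.ex_intro (fun p => p.1.2) ?_
    exact (Ent.refl _).right.right.and_intro (Ent.refl _).left.right.right
  · refine Ent.ex_elim (Ent.refl _) ?_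
    refine Ent.ex_elim (Ent.refl _).right.right ?_
    refine Ent.ex_intro (fun p => p.2) (Ent.and_intro ?_ (Ent.refl _).right.right)
    refine Ent.ex_intro (fun p => p.1.2) ?_
    exact (Ent.refl _).left.right.left.and_intro (Ent.refl _).right.left

end FunRel

/-- The effective topos as a category. -/
instance : Category.{0} Eff where
  Hom X Y := Quotient (FunRel.setoid X Y)
  id X := Quotient.mk _ (FunRel.id X)
  comp := Quotient.map₂ FunRel.comp fun _ _ h _ _ h' =>
    ⟨FunRel.comp_le h.1 h'.1, FunRel.comp_le h.2 h'.2⟩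
  id_comp := by rintro X Y ⟨F⟩; exact Quotient.sound F.id_comp
  comp_id := by rintro X Y ⟨F⟩; exact Quotient.sound F.comp_id
  assoc := by rintro X Y Z W ⟨F⟩ ⟨G⟩ ⟨H⟩; exact Quotient.sound (F.assoc G H)

/-- The morphism represented by a functional relation. -/
def FunRel.toHom {X Y : Eff} (F : FunRel X Y) : X ⟶ Y := Quotient.mk (FunRel.setoid X Y) F

/-! ### Constant objects -/

/-- The constant object on a set: `[x = y]` is `ℕ` if `x = y` and `∅` otherwise. -/
def nablaObj (S : Type) : Eff where
  carrier := S
  eq x y := {_n | x = y}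
  symm := Ent.of_subset fun _ _ h => Eq.symm h
  trans := Ent.of_subset fun _ _ ⟨_, h, _, h', _⟩ => Eq.trans h h'

def nablaRel {S T : Type} (f : S → T) : FunRel (nablaObj S) (nablaObj T) where
  rel x y := (nablaObj T).eq (f x) y
  strict := (Ent.of_subset fun _ _ _ => rfl).and_intro (Ent.of_subset fun _ _ _ => rfl)
  ext := Ent.of_subset fun _ _ ⟨_, h, _, ⟨_, h', _, h'', _⟩, _⟩ =>
    (congrArg f h).trans (Eq.trans h' h'')
  single := Ent.of_subset fun _ _ ⟨_, h, _, h', _⟩ => (Eq.symm h).trans h'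
  total := Ent.ex_intro f
    ((Ent.of_subset fun _ _ _ => rfl).and_intro (Ent.of_subset fun _ _ _ => rfl))

/-- The functor `∇` from sets to the effective topos. -/
def nabla : Type ⥤ Eff where
  obj := nablaObj
  map f := (nablaRel f).toHom
  map_id _ := Quotient.sound ⟨Ent.refl _, Ent.refl _⟩
  map_comp f g := Quotient.sound (by
    constructor
    · refine Ent.ex_intro (fun p => f p.1) ?_
      exact (Ent.of_subset fun _ _ _ => rfl).and_intro (Ent.refl _)
    · refine Ent.of_subset fun p n h => ?_
      obtain ⟨_, ⟨y, rfl⟩, _, h₁, _, h₂, _⟩ := h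
      exact (congrArg g h₁).trans h₂)

/-! ### Objects used in the interpretation of higher-order logic -/

def unit : Eff := nablaObj Unit

/-- The object of truth values: its equality predicate is equivalence. -/
def omega : Eff where
  carrier := Set ℕ
  eq p q := rand (rimp p q) (rimp q p)
  symm := (Ent.refl _).right.and_intro (Ent.refl _).left
  trans :=
    (Ent.imp_intro (Ent.mp (Ent.refl _).left.right.left
      (Ent.mp (Ent.refl _).left.left.left (Ent.refl _).right))).and_intro
    (Ent.imp_intro (Ent.mp (Ent.refl _).left.left.right
      (Ent.mp (Ent.refl _).left.right.right (Ent.refl _).right)))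

/-- The natural numbers object. -/
def nat : Eff where
  carrier := ℕ
  eq m n := {k | k = m ∧ m = n}
  symm := Ent.of_subset fun _ _ ⟨h, h'⟩ => ⟨h.trans h', h'.symm⟩
  trans := Ent.of_partrec _ Nat.Partrec.left fun _ _ ⟨a, ha, b, hb, h⟩ =>
    ⟨a, by simp [h], ha.1, ha.2.trans hb.2⟩

/-- Binary products. -/
def prod (X Y : Eff) : Eff where
  carrier := X.carrier × Y.carrier
  eq p q := rand (X.eq p.1 q.1) (Y.eq p.2 q.2)
  symm := (X.eq_symm (Ent.refl _).left).and_intro (Y.eq_symm (Ent.refl _).right)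
  trans := (X.eq_trans (Ent.refl _).left.left (Ent.refl _).right.left).and_intro
    (Y.eq_trans (Ent.refl _).left.right (Ent.refl _).right.right)

/-- The powerobject: `[A = B]` says that `A` and `B` are equivalent and that `A` is strict and
extensional. -/
def pow (X : Eff) : Eff where
  carrier := X.carrier → Set ℕ
  eq A B := rand (⋂ x, rimp (A x) (B x)) (rand (⋂ x, rimp (B x) (A x))
    (rand (⋂ x, rimp (A x) (X.ex x))
      (⋂ p : X.carrier × X.carrier, rimp (rand (A p.1) (X.eq p.1 p.2)) (A p.2))))
  symm := by
    refine (Ent.refl _).right.left.and_intro ((Ent.refl _).left.and_intro (Ent.and_intro ?_ ?_))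
    · refine Ent.all_intro (Ent.imp_intro (Ent.with_hyp fun h => ?_))
      have hAB := h.left.left
      have hBA := h.left.right.left
      have hs := h.left.right.right.left
      exact hs.all_mp (fun p => p.2) (hBA.all_mp (fun p => p.2) h.right)
    · refine Ent.all_intro (Ent.imp_intro (Ent.with_hyp fun h => ?_))
      have hAB := h.left.left
      have hBA := h.left.right.left
      have he := h.left.right.right.right
      have hx := hBA.all_mp (fun p => p.2.1) h.right.left
      exact hAB.all_mp (fun p => p.2.2) (he.all_mp (fun p => p.2) (hx.and_intro h.right.right))
  trans := by
    refine Ent.and_intro ?_ (Ent.and_intro ?_ (Ent.refl _).left.right.right)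
    · refine Ent.all_intro (Ent.imp_intro (Ent.with_hyp fun h => ?_))
      have h₁ := h.left.left.left
      have h₂ := h.left.right.left
      exact h₂.all_mp (fun p => p.2) (h₁.all_mp (fun p => p.2) h.right)
    · refine Ent.all_intro (Ent.imp_intro (Ent.with_hyp fun h => ?_))
      have h₁ := h.left.left.right.left
      have h₂ := h.left.right.right.left
      exact h₁.all_mp (fun p => p.2) (h₂.all_mp (fun p => p.2) h.right)

end Eff

/-! ## Higher-order intuitionistic logic

Simple type theory with one uninterpreted ground type `base`, product types, power types, a type of
truth values and a type of natural numbers. Terms are intrinsically typed, variables are de Bruijn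
indices, formulas are the terms of type `omega`. Functions are treated as functional relations. -/

namespace HOL

inductive Ty : Type
  | base : Ty
  | unit : Ty
  | omega : Ty
  | nat : Ty
  | prod : Ty → Ty → Ty
  | pow : Ty → Ty

/-- A context lists the types of the free variables. -/
abbrev Ctx := List Ty

inductive Var : Ctx → Ty → Type
  | here {Γ : Ctx} {a : Ty} : Var (a :: Γ) a
  | there {Γ : Ctx} {a b : Ty} : Var Γ a → Var (b :: Γ) a

inductive Tm : Ctx → Ty → Type
  | var {Γ : Ctx} {a : Ty} : Var Γ a → Tm Γ a
  | star {Γ : Ctx} : Tm Γ .unit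
  | pair {Γ : Ctx} {a b : Ty} : Tm Γ a → Tm Γ b → Tm Γ (.prod a b)
  /-- `compr φ` is the comprehension term `{x : a | φ}`. -/
  | compr {Γ : Ctx} {a : Ty} : Tm (a :: Γ) .omega → Tm Γ (.pow a)
  | mem {Γ : Ctx} {a : Ty} : Tm Γ a → Tm Γ (.pow a) → Tm Γ .omega
  | eq {Γ : Ctx} {a : Ty} : Tm Γ a → Tm Γ a → Tm Γ .omega
  | top {Γ : Ctx} : Tm Γ .omega
  | bot {Γ : Ctx} : Tm Γ .omega
  | and {Γ : Ctx} : Tm Γ .omega → Tm Γ .omega → Tm Γ .omega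
  | or {Γ : Ctx} : Tm Γ .omega → Tm Γ .omega → Tm Γ .omega
  | imp {Γ : Ctx} : Tm Γ .omega → Tm Γ .omega → Tm Γ .omega
  | all {Γ : Ctx} {a : Ty} : Tm (a :: Γ) .omega → Tm Γ .omega
  | ex {Γ : Ctx} {a : Ty} : Tm (a :: Γ) .omega → Tm Γ .omega
  | zero {Γ : Ctx} : Tm Γ .nat
  | succ {Γ : Ctx} : Tm Γ .nat → Tm Γ .nat

abbrev Fm (Γ : Ctx) := Tm Γ .omega

/-- Closed formulas. -/
abbrev Sentence := Fm []

/-! ### Renaming and substitution -/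

abbrev Ren (Γ Δ : Ctx) := ∀ a : Ty, Var Γ a → Var Δ a

def Ren.lift {Γ Δ : Ctx} (b : Ty) (r : Ren Γ Δ) : Ren (b :: Γ) (b :: Δ)
  | _, .here => .here
  | _, .there x => .there (r _ x)

def Tm.rename : {Γ : Ctx} → {a : Ty} → Tm Γ a → {Δ : Ctx} → Ren Γ Δ → Tm Δ a
  | _, _, .var x, _, r => .var (r _ x)
  | _, _, .star, _, _ => .star
  | _, _, .pair s t, _, r => .pair (s.rename r) (t.rename r)
  | _, _, .compr φ, _, r => .compr (φ.rename (r.lift _))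
  | _, _, .mem s t, _, r => .mem (s.rename r) (t.rename r)
  | _, _, .eq s t, _, r => .eq (s.rename r) (t.rename r)
  | _, _, .top, _, _ => .top
  | _, _, .bot, _, _ => .bot
  | _, _, .and φ ψ, _, r => .and (φ.rename r) (ψ.rename r)
  | _, _, .or φ ψ, _, r => .or (φ.rename r) (ψ.rename r)
  | _, _, .imp φ ψ, _, r => .imp (φ.rename r) (ψ.rename r)
  | _, _, .all φ, _, r => .all (φ.rename (r.lift _))
  | _, _, .ex φ, _, r => .ex (φ.rename (r.lift _))
  | _, _, .zero, _, _ => .zero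
  | _, _, .succ t, _, r => .succ (t.rename r)

/-- Weakening by one variable. -/
def Tm.wk {Γ : Ctx} {a b : Ty} (t : Tm Γ a) : Tm (b :: Γ) a := t.rename fun _ x => x.there

abbrev Sub (Γ Δ : Ctx) := ∀ a : Ty, Var Γ a → Tm Δ a

def Sub.lift {Γ Δ : Ctx} (b : Ty) (σ : Sub Γ Δ) : Sub (b :: Γ) (b :: Δ)
  | _, .here => .var .here
  | _, .there x => (σ _ x).wk

def Tm.subst : {Γ : Ctx} → {a : Ty} → Tm Γ a → {Δ : Ctx} → Sub Γ Δ → Tm Δ a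
  | _, _, .var x, _, σ => σ _ x
  | _, _, .star, _, _ => .star
  | _, _, .pair s t, _, σ => .pair (s.subst σ) (t.subst σ)
  | _, _, .compr φ, _, σ => .compr (φ.subst (σ.lift _))
  | _, _, .mem s t, _, σ => .mem (s.subst σ) (t.subst σ)
  | _, _, .eq s t, _, σ => .eq (s.subst σ) (t.subst σ)
  | _, _, .top, _, _ => .top
  | _, _, .bot, _, _ => .bot
  | _, _, .and φ ψ, _, σ => .and (φ.subst σ) (ψ.subst σ)
  | _, _, .or φ ψ, _, σ => .or (φ.subst σ) (ψ.subst σ)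
  | _, _, .imp φ ψ, _, σ => .imp (φ.subst σ) (ψ.subst σ)
  | _, _, .all φ, _, σ => .all (φ.subst (σ.lift _))
  | _, _, .ex φ, _, σ => .ex (φ.subst (σ.lift _))
  | _, _, .zero, _, _ => .zero
  | _, _, .succ t, _, σ => .succ (t.subst σ)

/-- The substitution of `t` for the most recent variable. -/
def Sub.one {Γ : Ctx} {b : Ty} (t : Tm Γ b) : Sub (b :: Γ) Γ
  | _, .here => t
  | _, .there x => .var x

/-- `φ.inst t` is `φ[t/x]`, for `x` the most recent variable. -/
def Tm.inst {Γ : Ctx} {a b : Ty} (s : Tm (b :: Γ) a) (t : Tm Γ b) : Tm Γ a := s.subst (Sub.one t)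

def Tm.neg {Γ : Ctx} (φ : Fm Γ) : Fm Γ := φ.imp .bot

def Tm.iff {Γ : Ctx} (φ ψ : Fm Γ) : Fm Γ := (φ.imp ψ).and (ψ.imp φ)

/-- The variables, counted from the most recent one. -/
def v0 {Γ : Ctx} {a : Ty} : Tm (a :: Γ) a := .var .here
def v1 {Γ : Ctx} {a b : Ty} : Tm (b :: a :: Γ) a := v0.wk
def v2 {Γ : Ctx} {a b c : Ty} : Tm (c :: b :: a :: Γ) a := v1.wk
def v3 {Γ : Ctx} {a b c d : Ty} : Tm (d :: c :: b :: a :: Γ) a := v2.wk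
def v4 {Γ : Ctx} {a b c d e : Ty} : Tm (e :: d :: c :: b :: a :: Γ) a := v3.wk
def v5 {Γ : Ctx} {a b c d e f : Ty} : Tm (f :: e :: d :: c :: b :: a :: Γ) a := v4.wk
def v6 {Γ : Ctx} {a b c d e f g : Ty} : Tm (g :: f :: e :: d :: c :: b :: a :: Γ) a := v5.wk

/-! ### Derivability -/

/-- Natural deduction for higher-order intuitionistic logic with the axioms `Ax`:
`Deriv Ax Γ Φ φ` says that `φ` follows from the hypotheses `Φ`, where the free variables of
all these formulas are in `Γ`. -/
inductive Deriv (Ax : Set Sentence) : (Γ : Ctx) → List (Fm Γ) → Fm Γ → Prop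
  | axm {Γ : Ctx} {Φ : List (Fm Γ)} {φ : Sentence} :
      φ ∈ Ax → Deriv Ax Γ Φ (φ.rename fun _ x => nomatch x)
  | hyp {Γ : Ctx} {Φ : List (Fm Γ)} {φ : Fm Γ} : φ ∈ Φ → Deriv Ax Γ Φ φ
  -- propositional connectives
  | top_intro {Γ : Ctx} {Φ : List (Fm Γ)} : Deriv Ax Γ Φ .top
  | bot_elim {Γ : Ctx} {Φ : List (Fm Γ)} {φ : Fm Γ} : Deriv Ax Γ Φ .bot → Deriv Ax Γ Φ φ
  | and_intro {Γ : Ctx} {Φ : List (Fm Γ)} {φ ψ : Fm Γ} :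
      Deriv Ax Γ Φ φ → Deriv Ax Γ Φ ψ → Deriv Ax Γ Φ (φ.and ψ)
  | and_left {Γ : Ctx} {Φ : List (Fm Γ)} {φ ψ : Fm Γ} : Deriv Ax Γ Φ (φ.and ψ) → Deriv Ax Γ Φ φ
  | and_right {Γ : Ctx} {Φ : List (Fm Γ)} {φ ψ : Fm Γ} : Deriv Ax Γ Φ (φ.and ψ) → Deriv Ax Γ Φ ψ
  | or_inl {Γ : Ctx} {Φ : List (Fm Γ)} {φ ψ : Fm Γ} : Deriv Ax Γ Φ φ → Deriv Ax Γ Φ (φ.or ψ)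
  | or_inr {Γ : Ctx} {Φ : List (Fm Γ)} {φ ψ : Fm Γ} : Deriv Ax Γ Φ ψ → Deriv Ax Γ Φ (φ.or ψ)
  | or_elim {Γ : Ctx} {Φ : List (Fm Γ)} {φ ψ χ : Fm Γ} : Deriv Ax Γ Φ (φ.or ψ) →
      Deriv Ax Γ (φ :: Φ) χ → Deriv Ax Γ (ψ :: Φ) χ → Deriv Ax Γ Φ χ
  | imp_intro {Γ : Ctx} {Φ : List (Fm Γ)} {φ ψ : Fm Γ} :
      Deriv Ax Γ (φ :: Φ) ψ → Deriv Ax Γ Φ (φ.imp ψ)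
  | imp_elim {Γ : Ctx} {Φ : List (Fm Γ)} {φ ψ : Fm Γ} :
      Deriv Ax Γ Φ (φ.imp ψ) → Deriv Ax Γ Φ φ → Deriv Ax Γ Φ ψ
  -- quantifiers
  | all_intro {Γ : Ctx} {Φ : List (Fm Γ)} {a : Ty} {φ : Fm (a :: Γ)} :
      Deriv Ax (a :: Γ) (Φ.map Tm.wk) φ → Deriv Ax Γ Φ φ.all
  | all_elim {Γ : Ctx} {Φ : List (Fm Γ)} {a : Ty} {φ : Fm (a :: Γ)} (t : Tm Γ a) :
      Deriv Ax Γ Φ φ.all → Deriv Ax Γ Φ (φ.inst t)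
  | ex_intro {Γ : Ctx} {Φ : List (Fm Γ)} {a : Ty} {φ : Fm (a :: Γ)} (t : Tm Γ a) :
      Deriv Ax Γ Φ (φ.inst t) → Deriv Ax Γ Φ φ.ex
  | ex_elim {Γ : Ctx} {Φ : List (Fm Γ)} {a : Ty} {φ : Fm (a :: Γ)} {χ : Fm Γ} :
      Deriv Ax Γ Φ φ.ex → Deriv Ax (a :: Γ) (φ :: Φ.map Tm.wk) χ.wk → Deriv Ax Γ Φ χ
  -- equality
  | eq_refl {Γ : Ctx} {Φ : List (Fm Γ)} {a : Ty} (t : Tm Γ a) : Deriv Ax Γ Φ (t.eq t)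
  | eq_subst {Γ : Ctx} {Φ : List (Fm Γ)} {a : Ty} {s t : Tm Γ a} (φ : Fm (a :: Γ)) :
      Deriv Ax Γ Φ (s.eq t) → Deriv Ax Γ Φ (φ.inst s) → Deriv Ax Γ Φ (φ.inst t)
  -- comprehension, extensionality of sets and of truth values
  | comprehension {Γ : Ctx} {Φ : List (Fm Γ)} {a : Ty} (φ : Fm (a :: Γ)) (t : Tm Γ a) :
      Deriv Ax Γ Φ ((Tm.mem t φ.compr).iff (φ.inst t))
  | set_ext {Γ : Ctx} {Φ : List (Fm Γ)} {a : Ty} {s t : Tm Γ (.pow a)} :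
      Deriv Ax Γ Φ (Tm.iff (Tm.mem v0 s.wk) (Tm.mem v0 t.wk)).all → Deriv Ax Γ Φ (s.eq t)
  | prop_ext {Γ : Ctx} {Φ : List (Fm Γ)} {φ ψ : Fm Γ} :
      Deriv Ax Γ Φ (φ.iff ψ) → Deriv Ax Γ Φ (Tm.eq φ ψ)
  -- unit and product types
  | unit_eta {Γ : Ctx} {Φ : List (Fm Γ)} (t : Tm Γ .unit) : Deriv Ax Γ Φ (t.eq .star)
  | pair_surj {Γ : Ctx} {Φ : List (Fm Γ)} {a b : Ty} (t : Tm Γ (.prod a b)) :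
      Deriv Ax Γ Φ (Tm.eq t.wk.wk (Tm.pair (v1 : Tm (b :: a :: Γ) a) v0)).ex.ex
  | pair_inj_left {Γ : Ctx} {Φ : List (Fm Γ)} {a b : Ty} {s s' : Tm Γ a} {t t' : Tm Γ b} :
      Deriv Ax Γ Φ (Tm.eq (s.pair t) (s'.pair t')) → Deriv Ax Γ Φ (s.eq s')
  | pair_inj_right {Γ : Ctx} {Φ : List (Fm Γ)} {a b : Ty} {s s' : Tm Γ a} {t t' : Tm Γ b} :
      Deriv Ax Γ Φ (Tm.eq (s.pair t) (s'.pair t')) → Deriv Ax Γ Φ (t.eq t')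
  -- natural numbers
  | succ_ne_zero {Γ : Ctx} {Φ : List (Fm Γ)} (t : Tm Γ .nat) :
      Deriv Ax Γ Φ (Tm.eq t.succ .zero).neg
  | succ_inj {Γ : Ctx} {Φ : List (Fm Γ)} {s t : Tm Γ .nat} :
      Deriv Ax Γ Φ (Tm.eq s.succ t.succ) → Deriv Ax Γ Φ (s.eq t)
  | induction {Γ : Ctx} {Φ : List (Fm Γ)} (s : Tm Γ (.pow .nat)) :
      Deriv Ax Γ Φ (Tm.mem .zero s) →
      Deriv Ax Γ Φ (Tm.imp (Tm.mem v0 s.wk) (Tm.mem v0.succ s.wk)).all →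
      Deriv Ax Γ Φ (Tm.mem v0 s.wk).all

/-- `φ` is provable from `Ax` in higher-order intuitionistic logic. -/
def Provable (Ax : Set Sentence) (φ : Sentence) : Prop := Deriv Ax [] [] φ

/-! ### Order theory in the internal language -/

/-- `t` is related to `s` by the relation `r`. -/
def rel {Γ : Ctx} {a b : Ty} (r : Tm Γ (.pow (.prod a b))) (s : Tm Γ a) (t : Tm Γ b) : Fm Γ :=
  .mem (s.pair t) r

section Order

variable {Γ : Ctx} {a b : Ty}

/-- Reflexive, transitive and antisymmetric. -/
def isPoset (le : Tm Γ (.pow (.prod a a))) : Fm Γ :=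
  (rel le.wk v0 v0).all.and
    ((((rel le.wk.wk.wk v2 v1).and (rel le.wk.wk.wk v1 v0)).imp
        (rel le.wk.wk.wk v2 v0)).all.all.all.and
      (((rel le.wk.wk v1 v0).and (rel le.wk.wk v0 v1)).imp (v1.eq v0)).all.all)

/-- `m` is the greatest lower bound of `x` and `y`. -/
def isGlb (le : Tm Γ (.pow (.prod a a))) (m x y : Tm Γ a) : Fm Γ :=
  ((rel le m x).and (rel le m y)).and
    (((rel le.wk v0 x.wk).and (rel le.wk v0 y.wk)).imp (rel le.wk v0 m.wk)).all

/-- `j` is the least upper bound of `x` and `y`. -/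
def isLub (le : Tm Γ (.pow (.prod a a))) (j x y : Tm Γ a) : Fm Γ :=
  ((rel le x j).and (rel le y j)).and
    (((rel le.wk x.wk v0).and (rel le.wk y.wk v0)).imp (rel le.wk j.wk v0)).all

/-- A poset in which every two elements have a greatest lower bound and a least upper bound. -/
def isLattice (le : Tm Γ (.pow (.prod a a))) : Fm Γ :=
  (isPoset le).and
    ((isGlb le.wk.wk.wk v0 v2 v1).ex.all.all.and (isLub le.wk.wk.wk v0 v2 v1).ex.all.all)

/-- `(x ∧ y) ∨ z = (x ∨ z) ∧ (y ∨ z)`: if `p = x ∧ y`, `q = x ∨ z`, `r = y ∨ z` and `w = p ∨ z`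
then `w = q ∧ r`. The variables `x, y, z, p, q, r, w` are `v6, …, v0`. -/
def supDistrib (le : Tm Γ (.pow (.prod a a))) : Fm Γ :=
  let l := le.wk.wk.wk.wk.wk.wk.wk
  ((((isGlb l v3 v6 v5).and (isLub l v2 v6 v4)).and
      ((isLub l v1 v5 v4).and (isLub l v0 v3 v4))).imp
    (isGlb l v0 v2 v1)).all.all.all.all.all.all.all

/-- `(x ∨ y) ∧ z = (x ∧ z) ∨ (y ∧ z)`: if `p = x ∨ y`, `q = x ∧ z`, `r = y ∧ z` and `w = p ∧ z`
then `w = q ∨ r`. The variables `x, y, z, p, q, r, w` are `v6, …, v0`. -/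
def infDistrib (le : Tm Γ (.pow (.prod a a))) : Fm Γ :=
  let l := le.wk.wk.wk.wk.wk.wk.wk
  ((((isLub l v3 v6 v5).and (isGlb l v2 v6 v4)).and
      ((isGlb l v1 v5 v4).and (isGlb l v0 v3 v4))).imp
    (isLub l v0 v2 v1)).all.all.all.all.all.all.all

def isDistribLattice (le : Tm Γ (.pow (.prod a a))) : Fm Γ :=
  (isLattice le).and ((supDistrib le).and (infDistrib le))

/-- `x` is an upper bound of the set `A`. -/
def bound (le : Tm Γ (.pow (.prod a a))) (x : Tm Γ a) (A : Tm Γ (.pow a)) : Fm Γ :=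
  ((Tm.mem v0 A.wk).imp (rel le.wk v0 x.wk)).all

/-- `z` is the supremum of the set `A`. -/
def isSup (le : Tm Γ (.pow (.prod a a))) (z : Tm Γ a) (A : Tm Γ (.pow a)) : Fm Γ :=
  (bound le z A).and ((bound le.wk v0 A.wk).imp (rel le.wk z.wk v0)).all

def isChain (le : Tm Γ (.pow (.prod a a))) (C : Tm Γ (.pow a)) : Fm Γ :=
  (((Tm.mem v1 C.wk.wk).and (Tm.mem v0 C.wk.wk)).imp
    ((rel le.wk.wk v1 v0).or (rel le.wk.wk v0 v1))).all.all

/-- Every chain has a supremum. -/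
def isChainComplete (le : Tm Γ (.pow (.prod a a))) : Fm Γ :=
  ((isChain le.wk v0).imp (isSup le.wk.wk v0 v1).ex).all

/-- `f` is (the graph of) a function from `a` to `b`. -/
def isFun (f : Tm Γ (.pow (.prod a b))) : Fm Γ :=
  (rel f.wk.wk v1 v0).ex.all.and
    (((rel f.wk.wk.wk v2 v1).and (rel f.wk.wk.wk v2 v0)).imp (v1.eq v0)).all.all.all

/-- `x ≤ y → f x ≤ f y`, for all `x, y`; here `f x` and `f y` are `v1` and `v0`. -/
def isMonotone (le f : Tm Γ (.pow (.prod a a))) : Fm Γ :=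
  (((rel f.wk.wk.wk.wk v3 v1).and (rel f.wk.wk.wk.wk v2 v0)).imp
    ((rel le.wk.wk.wk.wk v3 v2).imp (rel le.wk.wk.wk.wk v1 v0))).all.all.all.all

/-- `x ≤ f x`, for all `x`. -/
def isProgressive (le f : Tm Γ (.pow (.prod a a))) : Fm Γ :=
  ((rel f.wk.wk v1 v0).imp (rel le.wk.wk v1 v0)).all.all

/-- `f x = x`. -/
def isFixedPoint (f : Tm Γ (.pow (.prod a a))) (x : Tm Γ a) : Fm Γ := rel f x x

def hasFixedPoint (f : Tm Γ (.pow (.prod a a))) : Fm Γ := (isFixedPoint f.wk v0).ex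

end Order

/-- Tarski's theorem for chain-complete lattices: a monotone map on a chain-complete lattice has a
fixed point. The ground type carries the order `v1` and the map `v0`. -/
def tarski : Sentence :=
  Tm.all (a := .pow (.prod .base .base)) <| Tm.all (a := .pow (.prod .base .base)) <|
    (((isLattice v1).and (isChainComplete v1)).and ((isFun v0).and (isMonotone v1 v0))).imp
      (hasFixedPoint v0)

/-- The Bourbaki-Witt theorem: a progressive map on a chain-complete poset has a fixed point above
every point. -/
def bourbakiWitt : Sentence :=
  Tm.all (a := .pow (.prod .base .base)) <| Tm.all (a := .pow (.prod .base .base)) <|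
    (((isPoset v1).and (isChainComplete v1)).and ((isFun v0).and (isProgressive v1 v0))).imp
      ((rel v3 v1 v0).and (isFixedPoint v2 v0)).ex.all

/-- Dependent Choice for subsets of the type `a`: if `R` is a relation such that every `x ∈ S` is
related to some `y ∈ S`, then for every `x ∈ S` there is a sequence `F : ℕ → S` such that `F 0 = x`
and `F n` is related to `F (n + 1)` for all `n`. -/
def dependentChoice (a : Ty) : Sentence :=
  Tm.all (a := .pow a) <| Tm.all (a := .pow (.prod a a)) <|
    -- `S` is `v1`, `R` is `v0`
    ((Tm.mem v0 v2).imp ((Tm.mem v0 v3).and (rel v2 v1 v0)).ex).all.imp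
      ((Tm.mem v0 v2).imp (Tm.ex (a := .pow (.prod .nat a))
        -- `S` is `v3`, `R` is `v2`, `x` is `v1`, `F` is `v0`
        (((isFun v0).and (rel v0 .zero v1)).and
          ((((rel v2 v1 v0).imp (Tm.mem v0 v5)).all.all).and
            -- `S` is `v6`, `R` is `v5`, `F` is `v3`, and `n, y, z` are `v2, v1, v0`
            (((rel v3 v2 v1).and (rel v3 v2.succ v0)).imp (rel v5 v1 v0)).all.all.all)))).all

/-- Dependent Choice at all types. -/
def DC : Set Sentence := Set.range dependentChoice

/-! ### Interpretation in the effective topos -/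

/-- The interpretation of types, where the ground type is interpreted as `X`. -/
def Ty.interp (X : Eff) : Ty → Eff
  | .base => X
  | .unit => Eff.unit
  | .omega => Eff.omega
  | .nat => Eff.nat
  | .prod a b => Eff.prod (a.interp X) (b.interp X)
  | .pow a => Eff.pow (a.interp X)

abbrev Env (X : Eff) (Γ : Ctx) := ∀ a : Ty, Var Γ a → (a.interp X).carrier

def Env.nil (X : Eff) : Env X [] := fun _ x => nomatch x

def Env.cons {X : Eff} {Γ : Ctx} {b : Ty} (u : (b.interp X).carrier) (ρ : Env X Γ) :
    Env X (b :: Γ)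
  | _, .here => u
  | _, .there x => ρ _ x

/-- The realizability interpretation of terms; a formula is sent to its set of realizers. -/
def Tm.eval (X : Eff) : {Γ : Ctx} → {a : Ty} → Tm Γ a → Env X Γ → (a.interp X).carrier
  | _, _, .var x, ρ => ρ _ x
  | _, _, .star, _ => ()
  | _, _, .pair s t, ρ => (s.eval X ρ, t.eval X ρ)
  | _, .pow a, .compr φ, ρ => fun u => rand ((a.interp X).ex u) (φ.eval X (Env.cons u ρ))
  | _, _, .mem (a := a) s t, ρ => rand ((a.interp X).ex (s.eval X ρ))
      (rand ((Ty.pow a).interp X |>.ex (t.eval X ρ))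
        ((t.eval X ρ : (a.interp X).carrier → Set ℕ) (s.eval X ρ)))
  | _, _, .eq (a := a) s t, ρ => (a.interp X).eq (s.eval X ρ) (t.eval X ρ)
  | _, _, .top, _ => (Set.univ : Set ℕ)
  | _, _, .bot, _ => (∅ : Set ℕ)
  | _, _, .and φ ψ, ρ => rand (φ.eval X ρ) (ψ.eval X ρ)
  | _, _, .or φ ψ, ρ => ror (φ.eval X ρ) (ψ.eval X ρ)
  | _, _, .imp φ ψ, ρ => rimp (φ.eval X ρ) (ψ.eval X ρ)
  | _, _, .all (a := a) φ, ρ =>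
      (⋂ u, rimp ((a.interp X).ex u) (φ.eval X (Env.cons u ρ)) : Set ℕ)
  | _, _, .ex (a := a) φ, ρ =>
      (⋃ u, rand ((a.interp X).ex u) (φ.eval X (Env.cons u ρ)) : Set ℕ)
  | _, _, .zero, _ => (0 : ℕ)
  | _, _, .succ t, ρ => Nat.succ (t.eval X ρ)

/-- The sentence `φ` is valid in the effective topos when the ground type is interpreted as `X`. -/
def ValidIn (X : Eff) (φ : Sentence) : Prop := (show Set ℕ from φ.eval X (Env.nil X)).Nonempty

/-- The context of an order and an endomap on the ground type. -/
abbrev orderCtx : Ctx := [.pow (.prod .base .base), .pow (.prod .base .base)]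

/-- `Holds X le f φ`: the formula `φ` about an order `v1` and an endomap `v0` of the ground type is
valid in the internal language of the effective topos for the object `X`, the subobject of `X × X`
represented by `le`, and the morphism `f : X ⟶ X`. The set of realizers has to be inhabited for
every functional relation that represents `f`. -/
def Holds (X : Eff) (le : Eff.StrictPred (Eff.prod X X)) (f : X ⟶ X) (φ : Fm orderCtx) : Prop :=
  ∀ F : Eff.FunRel X X, F.toHom = f →
    (show Set ℕ from φ.eval X (Env.cons (b := .pow (.prod .base .base)) (fun p => F.rel p.1 p.2)
      (Env.cons (b := .pow (.prod .base .base)) le.pred (Env.nil X)))).Nonempty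

end HOL

/-! ## The object `∇ω₁` -/

namespace Eff

/-- The set of countable ordinals. -/
abbrev Omega1 : Type := (Ordinal.omega 1).ToType

/-- The map `∇succ` on `∇ω₁`, where `succ` sends a countable ordinal to its successor. -/
noncomputable def nablaSucc : nabla.obj Omega1 ⟶ nabla.obj Omega1 :=
  nabla.map (TypeCat.ofHom Order.succ)

/-- The order `∇≤` on `∇S`, as a subobject of `∇S × ∇S`. -/
def nablaLe (S : Type) [LE S] : StrictPred (prod (nabla.obj S) (nabla.obj S)) where
  pred := fun p : S × S => {_n | p.1 ≤ p.2}
  strict := (Ent.of_subset fun _ _ _ => rfl).and_intro (Ent.of_subset fun _ _ _ => rfl)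
  ext := Ent.of_subset fun p _ ⟨_, h, _, ⟨_, h₁, _, h₂, _⟩, _⟩ => by
    have e₁ : p.1.1 = p.2.1 := h₁
    have e₂ : p.1.2 = p.2.2 := h₂
    have h' : @LE.le S _ p.1.1 p.1.2 := h
    show @LE.le S _ p.2.1 p.2.2
    rwa [← e₁, ← e₂]

end Eff

/-!
In the effective topos a chain `C` in a constant poset `∇S` has at most countably many elements
(`HOL.countable_support_of_isChain`). Its realizer is a program that computes from realizers of
`x ∈ C` and `y ∈ C` which of `x ≤ y` and `y ≤ x` to believe. If the same number realizes `x ∈ C` and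
`y ∈ C`, then the program gives the same answer for the pair `x, y` and for the pair `y, x`, so
both inequalities hold and `x = y`. Thus distinct elements have distinct realizers. As
countable sets of countable ordinals are bounded, every internal chain in `∇ω₁` has a supremum,
although `ω₁` has no greatest element and the successor map has no fixed point.

The other internal properties of `∇ω₁` and `∇succ` are read off from their classical counterparts.
The order of `∇ω₁` is `Uniform`: one number realizes all its true instances. Uniform formulas are
closed under conjunction, under implication from arbitrary hypotheses, and under quantification over
`∇ω₁`, and such a formula is realized iff it is true. This covers the distributive lattice axioms,
monotonicity, progressiveness, absence of fixed points, and the statement that an element is the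
supremum of a given set.

Unprovability follows from soundness (`HOL.Deriv.sound`): derivable sequents are realized. This
rests on the fact that the interpretation of terms commutes with substitution (`HOL.Tm.eval_subst`)
and respects equality (`HOL.Tm.congr`). Soundness and respect for equality are stated for families of
environments over an arbitrary index set with an arbitrary hypothesis, so that the rules for
binders are instances of the entailment calculus. The axioms of Dependent Choice are realized
(`HOL.dependentChoice_valid`): the realizer of totality is iterated by primitive recursion on
realizers, while a sequence of elements matching these realizers is chosen classically.
-/

namespace Realizability

/-! ### Entailment: disjunction, induction and dependent choice -/

theorem Ent.top {I : Type} (C : I → Set ℕ) : Ent C (fun _ => Set.univ) :=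
  Ent.of_subset fun _ _ _ => trivial

theorem Ent.of_eq {I : Type} {A B C : I → Set ℕ} (h : Ent C A)
    (e : ∀ i, A i = B i) : Ent C B :=
  h.trans (Ent.of_subset fun i => (e i).le)

/-- Weakening by a hypothesis. -/
theorem Ent.wk {I : Type} {C A : I → Set ℕ} (D : I → Set ℕ) (h : Ent C A) :
    Ent (fun i => rand (C i) (D i)) A :=
  (Ent.and_left' C D).trans h

/-- Weakening by a variable. -/
theorem Ent.wkIdx {I : Type} (J : Type) {C A : I → Set ℕ} (h : Ent C A) :
    Ent (fun p : I × J => C p.1) (fun p => A p.1) :=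
  h.reindex Prod.fst

theorem Ent.imp_elim {I : Type} {A B C : I → Set ℕ} (h : Ent C (fun i => rimp (A i) (B i))) :
    Ent (fun i => rand (C i) (A i)) B :=
  (h.wk A).mp (Ent.and_right' C A)

/-- Quantification over the elements of an object is relativized to its existence predicate; this
is the introduction rule for such quantifiers. -/
theorem Ent.all_imp_intro {I J : Type} {C : I → Set ℕ} {P Q : I → J → Set ℕ}
    (h : Ent (fun p : I × J => rand (C p.1) (P p.1 p.2)) (fun p => Q p.1 p.2)) :
    Ent C (fun i => ⋂ j, rimp (P i j) (Q i j)) :=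
  Ent.all_intro (Ent.imp_intro h)

theorem Ent.ex_and_intro {I J : Type} {C : I → Set ℕ} {P Q : I → J → Set ℕ} (f : I → J)
    (h : Ent C (fun i => P i (f i))) (h' : Ent C (fun i => Q i (f i))) :
    Ent C (fun i => ⋃ j, rand (P i j) (Q i j)) :=
  Ent.ex_intro f (h.and_intro h')

theorem Ent.or_inl {I : Type} {A C : I → Set ℕ} (B : I → Set ℕ) (h : Ent C A) :
    Ent C (fun i => ror (A i) (B i)) := by
  have hp : Computable fun n : ℕ => Nat.pair 0 n :=
    Primrec₂.natPair.to_comp.comp (Computable.const 0) Computable.id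
  exact h.trans (Ent.of_partrec _ (Partrec.nat_iff.1 hp) fun i m hm =>
    ⟨_, Part.mem_some _, Or.inl ⟨m, hm, rfl⟩⟩)

theorem Ent.or_inr {I : Type} {B C : I → Set ℕ} (A : I → Set ℕ) (h : Ent C B) :
    Ent C (fun i => ror (A i) (B i)) := by
  have hp : Computable fun n : ℕ => Nat.pair 1 n :=
    Primrec₂.natPair.to_comp.comp (Computable.const 1) Computable.id
  exact h.trans (Ent.of_partrec _ (Partrec.nat_iff.1 hp) fun i m hm =>
    ⟨_, Part.mem_some _, Or.inr ⟨m, hm, rfl⟩⟩)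

/-- The realizer of a case distinction reads the tag of the realizer of the disjunction. -/
theorem Ent.or_elim {I : Type} {A B C D : I → Set ℕ} (h : Ent C (fun i => ror (A i) (B i)))
    (hA : Ent (fun i => rand (C i) (A i)) D) (hB : Ent (fun i => rand (C i) (B i)) D) :
    Ent C D := by
  refine ((Ent.refl C).and_intro h).trans ?_
  obtain ⟨f, hf, hf'⟩ := hA.partrec
  obtain ⟨g, hg, hg'⟩ := hB.partrec
  have ht : Computable fun n : ℕ => n.unpair.2.unpair.1 :=
    Computable.fst.comp (Computable.unpair.comp (Computable.snd.comp Computable.unpair))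
  have hv : Computable fun n : ℕ => Nat.pair n.unpair.1 n.unpair.2.unpair.2 :=
    Primrec₂.natPair.to_comp.comp (Computable.fst.comp Computable.unpair)
      (Computable.snd.comp (Computable.unpair.comp (Computable.snd.comp Computable.unpair)))
  have hc : Computable fun n : ℕ => decide (n.unpair.2.unpair.1 = 0) :=
    (Primrec.eq.decide.to_comp).comp ht (Computable.const 0)
  have hp := Partrec.cond hc ((Partrec.nat_iff.2 hf).comp hv) ((Partrec.nat_iff.2 hg).comp hv)
  refine Ent.of_partrec _ (Partrec.nat_iff.1 hp) fun i m hm => ?_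
  obtain ⟨c, hc, k, ⟨n, hn, rfl⟩ | ⟨n, hn, rfl⟩, rfl⟩ := hm
  · simpa using hf' i _ ⟨c, hc, n, hn, rfl⟩
  · simpa using hg' i _ ⟨c, hc, n, hn, rfl⟩

/-- Induction is realized by primitive recursion. -/
theorem Ent.nat_induction {I : Type} {C : I → Set ℕ} {P : I → ℕ → Set ℕ}
    (h0 : Ent C (fun i => P i 0))
    (hs : Ent (fun p : I × ℕ => rand (rand (C p.1) (Eff.nat.ex p.2)) (P p.1 p.2))
      (fun p => P p.1 (p.2 + 1))) :
    Ent (fun p : I × ℕ => rand (C p.1) (Eff.nat.ex p.2)) (fun p => P p.1 p.2) := by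
  obtain ⟨f, hf, hf'⟩ := h0.partrec
  obtain ⟨g, hg, hg'⟩ := hs.partrec
  have hp := Partrec.nat_rec (f := fun n : ℕ => n.unpair.2) (g := fun n : ℕ => f n.unpair.1)
    (h := fun (n : ℕ) (p : ℕ × ℕ) => g (Nat.pair (Nat.pair n.unpair.1 p.1) p.2))
    (Computable.snd.comp Computable.unpair)
    ((Partrec.nat_iff.2 hf).comp (Computable.fst.comp Computable.unpair))
    ((Partrec.nat_iff.2 hg).comp (Primrec₂.natPair.to_comp.comp
      (Primrec₂.natPair.to_comp.comp
        (Computable.fst.comp (Computable.unpair.comp Computable.fst))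
        (Computable.fst.comp Computable.snd))
      (Computable.snd.comp Computable.snd)))
  refine Ent.of_partrec _ (Partrec.nat_iff.1 hp) fun p m hm => ?_
  obtain ⟨i, k⟩ := p
  obtain ⟨c, hc, k', ⟨hk, -⟩, rfl⟩ := hm
  obtain rfl : k' = k := hk
  change c ∈ C i at hc
  simp only [Nat.unpair_pair]
  induction k' with
  | zero => simpa using hf' i c hc
  | succ k ih =>
    obtain ⟨a, ha, ha'⟩ := ih
    obtain ⟨b, hb, hb'⟩ := hg' (i, k) _ ⟨_, ⟨c, hc, k, ⟨rfl, rfl⟩, rfl⟩, a, ha', rfl⟩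
    exact ⟨b, Part.mem_bind_iff.2 ⟨a, ha, hb⟩, hb'⟩

/-- An entailment may be checked on one realizer of the hypothesis at a time; so the objects that
witness an existential conclusion may depend on that realizer. -/
theorem Ent.of_singleton {I : Type} {C D : I → Set ℕ}
    (h : Ent (fun q : {p : I × ℕ // p.2 ∈ C p.1} => {q.1.2}) (fun q => D q.1.1)) : Ent C D := by
  -- A program realizes the entailment on the refined index set iff it does so on `I`.
  obtain ⟨n, hn⟩ := h
  exact ⟨n, fun i m hm => hn ⟨(i, m), hm⟩ m rfl⟩

/-- Dependent choice for non-standard predicates: the realizers of a sequence are computed by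
primitive recursion, the sequence itself is chosen along with them. -/
theorem Ent.dependent_choice {I T : Type} {C : I → Set ℕ} {E : I → T → Set ℕ}
    {Q : I → T → T → Set ℕ} (x : I → T) (h0 : Ent C (fun i => E i (x i)))
    (hs : Ent (fun p : I × T => rand (C p.1) (E p.1 p.2))
      (fun p => ⋃ y, rand (E p.1 y) (Q p.1 p.2 y))) :
    Ent C (fun i => ⋃ y : ℕ → T, rand {_n | y 0 = x i}
      (⋂ n : ℕ, rimp (Eff.nat.ex n) (rand (E i (y n)) (Q i (y n) (y (n + 1)))))) := by
  obtain ⟨f, hf, hf'⟩ := h0.partrec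
  obtain ⟨g, hg, hg'⟩ := hs.partrec
  -- A state is an element with a realizer of `E` at it.
  let St := fun i => {s : T × ℕ // s.2 ∈ E i s.1}
  have hstart : ∀ q : {p : I × ℕ // p.2 ∈ C p.1}, ∃ s : St q.1.1,
      s.1.1 = x q.1.1 ∧ s.1.2 ∈ f q.1.2 := by
    rintro ⟨⟨i, c⟩, hc⟩
    obtain ⟨k, hk, hk'⟩ := hf' i c hc
    exact ⟨⟨(x i, k), hk'⟩, rfl, hk⟩
  have hnext : ∀ (q : {p : I × ℕ // p.2 ∈ C p.1}) (s : St q.1.1), ∃ s' : St q.1.1,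
      ∃ b ∈ Q q.1.1 s.1.1 s'.1.1, Nat.pair s'.1.2 b ∈ g (Nat.pair q.1.2 s.1.2) := by
    rintro ⟨⟨i, c⟩, hc⟩ ⟨⟨t, e⟩, he⟩
    obtain ⟨k, hk, hk'⟩ := hg' (i, t) _ ⟨c, hc, e, he, rfl⟩
    obtain ⟨y, a, ha, b, hb, rfl⟩ := Set.mem_iUnion.1 hk'
    exact ⟨⟨(y, a), ha⟩, b, hb, hk⟩
  choose start hstart₁ hstart₂ using hstart
  choose next hnext using hnext
  let st := fun (q : {p : I × ℕ // p.2 ∈ C p.1}) (n : ℕ) =>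
    Nat.rec (motive := fun _ => St q.1.1) (start q) (fun _ s => next q s) n
  -- The numbers in the states are computable, since the realizer of the step already determines
  -- the next number; only the elements are chosen.
  have hcode : Ent (fun p : {p : I × ℕ // p.2 ∈ C p.1} × ℕ => rand {p.1.1.2} (Eff.nat.ex p.2))
      (fun p => {(st p.1 p.2).1.2}) := by
    refine Ent.nat_induction (C := fun q : {p : I × ℕ // p.2 ∈ C p.1} => {q.1.2})
      (P := fun q n => {(st q n).1.2}) ?_ ?_
    · refine Ent.of_partrec f hf ?_
      rintro q _ rfl
      exact ⟨_, hstart₂ q, rfl⟩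
    · refine Ent.trans (Ent.and_intro (Ent.refl _).left.left (Ent.refl _).right)
        (Ent.of_partrec _ (Nat.Partrec.left.comp hg) ?_)
      rintro ⟨q, n⟩ _ ⟨_, rfl, _, rfl, rfl⟩
      obtain ⟨b, -, hb⟩ := hnext q (st q n)
      exact ⟨_, Part.mem_bind_iff.2 ⟨_, hb, Part.mem_some _⟩, by simp [st]⟩
  have hstep : Ent
      (fun p : {p : I × ℕ // p.2 ∈ C p.1} × ℕ => rand {p.1.1.2} {(st p.1 p.2).1.2})
      (fun p => Q p.1.1.1 (st p.1 p.2).1.1 (st p.1 (p.2 + 1)).1.1) := by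
    refine Ent.of_partrec _ (Nat.Partrec.right.comp hg) ?_
    rintro ⟨q, n⟩ _ ⟨_, rfl, _, rfl, rfl⟩
    obtain ⟨b, hb', hb⟩ := hnext q (st q n)
    exact ⟨_, Part.mem_bind_iff.2 ⟨_, hb, Part.mem_some _⟩, by simpa using hb'⟩
  -- The chosen sequence depends on the realizer of `C` it starts from.
  refine Ent.of_singleton (Ent.ex_and_intro (fun q n => (st q n).1.1) ?_ ?_)
  · exact Ent.of_subset fun q _ _ => hstart₁ q
  · refine Ent.all_imp_intro (Ent.and_intro ?_ ?_)
    · refine hcode.trans (Ent.of_subset ?_)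
      rintro ⟨q, n⟩ _ rfl
      exact (st q n).2
    · exact ((Ent.refl _).left.and_intro hcode).trans hstep

end Realizability

namespace HOL

/-! ### Renaming, substitution and equality of environments -/

theorem Env.cons_lift {X : Eff} {Γ Δ : Ctx} {b : Ty} (r : Ren Γ Δ) (u : (b.interp X).carrier)
    (ρ : Env X Δ) :
    (fun a x => Env.cons u ρ a (r.lift b a x)) = Env.cons u (fun a x => ρ a (r a x)) := by
  funext a x
  cases x <;> rfl

theorem Tm.eval_rename (X : Eff) {Γ Δ : Ctx} {a : Ty} (t : Tm Γ a) (r : Ren Γ Δ) (ρ : Env X Δ) :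
    (t.rename r).eval X ρ = t.eval X (fun a x => ρ a (r a x)) := by
  induction t generalizing Δ <;> simp only [Tm.rename, Tm.eval, Env.cons_lift, *] <;> rfl

theorem Tm.eval_wk (X : Eff) {Γ : Ctx} {a b : Ty} (t : Tm Γ a) (u : (b.interp X).carrier)
    (ρ : Env X Γ) : t.wk.eval X (Env.cons u ρ) = t.eval X ρ :=
  t.eval_rename X _ _

theorem Env.cons_sub_lift {X : Eff} {Γ Δ : Ctx} {b : Ty} (σ : Sub Γ Δ) (u : (b.interp X).carrier)
    (ρ : Env X Δ) :
    (fun a x => (σ.lift b a x).eval X (Env.cons u ρ)) =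
      Env.cons u (fun a x => (σ a x).eval X ρ) := by
  funext a x
  cases x with
  | here => rfl
  | there x => exact Tm.eval_wk X _ _ _

theorem Tm.eval_subst (X : Eff) {Γ Δ : Ctx} {a : Ty} (t : Tm Γ a) (σ : Sub Γ Δ) (ρ : Env X Δ) :
    (t.subst σ).eval X ρ = t.eval X (fun a x => (σ a x).eval X ρ) := by
  induction t generalizing Δ <;> simp only [Tm.subst, Tm.eval, Env.cons_sub_lift, *] <;> rfl

theorem Tm.eval_inst (X : Eff) {Γ : Ctx} {a b : Ty} (s : Tm (b :: Γ) a) (t : Tm Γ b)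
    (ρ : Env X Γ) : (s.inst t).eval X ρ = s.eval X (Env.cons (t.eval X ρ) ρ) := by
  refine (s.eval_subst X _ _).trans (congrArg _ ?_)
  funext a x
  cases x <;> rfl

/-- Equality of environments, as a set of realizers: the conjunction of the equalities of the
values of all variables. -/
def Env.equal {X : Eff} : {Γ : Ctx} → Env X Γ → Env X Γ → Set ℕ
  | [], _, _ => Set.univ
  | b :: _, ρ, ρ' => rand (Env.equal (fun a x => ρ a x.there) (fun a x => ρ' a x.there))
      ((b.interp X).eq (ρ b .here) (ρ' b .here))

theorem Env.equal_symm {X : Eff} {Γ : Ctx} {I : Type} {C : I → Set ℕ} {ρ ρ' : I → Env X Γ}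
    (h : Ent C (fun i => Env.equal (ρ i) (ρ' i))) :
    Ent C (fun i => Env.equal (ρ' i) (ρ i)) := by
  induction Γ with
  | nil => exact Ent.top C
  | cons b Γ ih => exact (ih h.left).and_intro ((b.interp X).eq_symm h.right)

theorem Env.equal_trans {X : Eff} {Γ : Ctx} {I : Type} {C : I → Set ℕ} {ρ ρ' ρ'' : I → Env X Γ}
    (h : Ent C (fun i => Env.equal (ρ i) (ρ' i))) (h' : Ent C (fun i => Env.equal (ρ' i) (ρ'' i))) :
    Ent C (fun i => Env.equal (ρ i) (ρ'' i)) := by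
  induction Γ with
  | nil => exact Ent.top C
  | cons b Γ ih => exact (ih h.left h'.left).and_intro ((b.interp X).eq_trans h.right h'.right)

theorem Env.equal_cons {X : Eff} {Γ : Ctx} {b : Ty} {I : Type} {C : I → Set ℕ}
    {ρ ρ' : I → Env X Γ} {u u' : I → (b.interp X).carrier}
    (h : Ent C (fun i => Env.equal (ρ i) (ρ' i)))
    (h' : Ent C (fun i => (b.interp X).eq (u i) (u' i))) :
    Ent C (fun i => Env.equal (Env.cons (u i) (ρ i)) (Env.cons (u' i) (ρ' i))) :=
  h.and_intro h'

theorem Env.equal_var {X : Eff} {Γ : Ctx} {a : Ty} (x : Var Γ a) {I : Type} {C : I → Set ℕ}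
    {ρ ρ' : I → Env X Γ} (h : Ent C (fun i => Env.equal (ρ i) (ρ' i))) :
    Ent C (fun i => (a.interp X).eq (ρ i a x) (ρ' i a x)) := by
  induction x with
  | here => exact h.right
  | there x ih => exact ih h.left

/-- The set of realizers of a formula. -/
abbrev Tm.realizers (X : Eff) {Γ : Ctx} (φ : Fm Γ) (ρ : Env X Γ) : Set ℕ := φ.eval X ρ

/-- Quantifiers range over the elements that exist. -/
theorem Tm.all_elim {X : Eff} {Γ : Ctx} {b : Ty} {φ : Fm (b :: Γ)} {I : Type} {C : I → Set ℕ}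
    {ρ : I → Env X Γ} {u : I → (b.interp X).carrier}
    (h : Ent C (fun i => φ.all.realizers X (ρ i))) (h' : Ent C (fun i => (b.interp X).ex (u i))) :
    Ent C (fun i => φ.realizers X (Env.cons (u i) (ρ i))) :=
  Ent.all_mp (P := fun _ u => (b.interp X).ex u) (Q := fun i u => φ.realizers X (Env.cons u (ρ i)))
    h u h'

theorem Tm.all_intro {X : Eff} {Γ : Ctx} {b : Ty} {φ : Fm (b :: Γ)} {I : Type} {C : I → Set ℕ}
    {ρ : I → Env X Γ}
    (h : Ent (fun p : I × (b.interp X).carrier => rand (C p.1) ((b.interp X).ex p.2))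
      (fun p => φ.realizers X (Env.cons p.2 (ρ p.1)))) :
    Ent C (fun i => φ.all.realizers X (ρ i)) :=
  Ent.all_imp_intro (P := fun _ u => (b.interp X).ex u)
    (Q := fun i u => φ.realizers X (Env.cons u (ρ i))) h

theorem Tm.ex_intro {X : Eff} {Γ : Ctx} {b : Ty} {φ : Fm (b :: Γ)} {I : Type} {C : I → Set ℕ}
    {ρ : I → Env X Γ} {u : I → (b.interp X).carrier} (h : Ent C (fun i => (b.interp X).ex (u i)))
    (h' : Ent C (fun i => φ.realizers X (Env.cons (u i) (ρ i)))) :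
    Ent C (fun i => φ.ex.realizers X (ρ i)) :=
  Ent.ex_and_intro (P := fun _ u => (b.interp X).ex u)
    (Q := fun i u => φ.realizers X (Env.cons u (ρ i))) u h h'

theorem Tm.ex_elim {X : Eff} {Γ : Ctx} {b : Ty} {φ : Fm (b :: Γ)} {I : Type} {C D : I → Set ℕ}
    {ρ : I → Env X Γ} (h : Ent C (fun i => φ.ex.realizers X (ρ i)))
    (h' : Ent (fun p : I × (b.interp X).carrier => rand (C p.1)
      (rand ((b.interp X).ex p.2) (φ.realizers X (Env.cons p.2 (ρ p.1))))) (fun p => D p.1)) :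
    Ent C D :=
  Ent.ex_elim (P := fun i u => rand ((b.interp X).ex u) (φ.realizers X (Env.cons u (ρ i)))) h h'

/-- Equality of truth values is equivalence. -/
theorem omega_mp {X : Eff} {I : Type} {A B C : I → Set ℕ}
    (h : Ent C (fun i => (Ty.omega.interp X).eq (A i) (B i))) (h' : Ent C A) : Ent C B :=
  Ent.mp (A := A) (B := B) (Ent.left (B := fun i => rimp (B i) (A i)) h) h'

/-- Equal sets have the same elements. -/
theorem pow_mp {X : Eff} {I : Type} {C : I → Set ℕ} {A B : I → X.carrier → Set ℕ}
    (h : Ent C (fun i => X.pow.eq (A i) (B i))) (x : I → X.carrier)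
    (h' : Ent C (fun i => A i (x i))) : Ent C (fun i => B i (x i)) :=
  (Ent.left h).all_mp (P := A) (Q := B) x h'

/-- A set that exists has only elements that exist. -/
theorem pow_strict {X : Eff} {I : Type} {C : I → Set ℕ} {A : I → X.carrier → Set ℕ}
    (h : Ent C (fun i => X.pow.ex (A i))) (x : I → X.carrier)
    (h' : Ent C (fun i => A i (x i))) : Ent C (fun i => X.ex (x i)) :=
  (Ent.left (Ent.right (Ent.right h))).all_mp (P := A) (Q := fun _ x => X.ex x) x h'

/-- A set that exists is closed under equality of elements. -/
theorem pow_ext {X : Eff} {I : Type} {C : I → Set ℕ} {A : I → X.carrier → Set ℕ}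
    (h : Ent C (fun i => X.pow.ex (A i))) {x y : I → X.carrier}
    (h' : Ent C (fun i => A i (x i))) (h'' : Ent C (fun i => X.eq (x i) (y i))) :
    Ent C (fun i => A i (y i)) :=
  (Ent.right (Ent.right (Ent.right h))).all_mp
    (P := fun i (p : X.carrier × X.carrier) => rand (A i p.1) (X.eq p.1 p.2))
    (Q := fun i (p : X.carrier × X.carrier) => A i p.2) (fun i => (x i, y i)) (h'.and_intro h'')

theorem pow_eq_intro {X : Eff} {I : Type} {C : I → Set ℕ} {A B : I → X.carrier → Set ℕ}
    (h₁ : Ent (fun p : I × X.carrier => rand (C p.1) (A p.1 p.2)) (fun p => B p.1 p.2))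
    (h₂ : Ent (fun p : I × X.carrier => rand (C p.1) (B p.1 p.2)) (fun p => A p.1 p.2))
    (h₃ : Ent (fun p : I × X.carrier => rand (C p.1) (A p.1 p.2)) (fun p => X.ex p.2))
    (h₄ : Ent (fun p : I × X.carrier × X.carrier =>
      rand (C p.1) (rand (A p.1 p.2.1) (X.eq p.2.1 p.2.2))) (fun p => A p.1 p.2.2)) :
    Ent C (fun i => X.pow.eq (A i) (B i)) :=
  (Ent.all_imp_intro h₁).and_intro ((Ent.all_imp_intro h₂).and_intro
    ((Ent.all_imp_intro h₃).and_intro (Ent.all_imp_intro h₄)))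

/-- A set that exists equals every set with the same elements. -/
theorem pow_eq_of_ex {X : Eff} {I : Type} {C : I → Set ℕ} {A B : I → X.carrier → Set ℕ}
    (h : Ent C (fun i => X.pow.ex (A i)))
    (h₁ : Ent (fun p : I × X.carrier => rand (C p.1) (A p.1 p.2)) (fun p => B p.1 p.2))
    (h₂ : Ent (fun p : I × X.carrier => rand (C p.1) (B p.1 p.2)) (fun p => A p.1 p.2)) :
    Ent C (fun i => X.pow.eq (A i) (B i)) :=
  pow_eq_intro h₁ h₂ (pow_strict (A := fun p : I × X.carrier => A p.1) ((h.wkIdx _).wk _) _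
      (Ent.refl _).right)
    (pow_ext (A := fun p : I × X.carrier × X.carrier => A p.1) ((h.wkIdx _).wk _)
      (Ent.refl _).right.left (Ent.refl _).right.right)

/-- To show that a formula respects equality of environments it suffices to transport its
realizers in one direction. -/
theorem omega_eq_of_transport {X : Eff} {Γ : Ctx} {φ : Fm Γ} {I : Type} {C : I → Set ℕ}
    (H : ∀ ρ ρ' : I → Env X Γ, Ent C (fun i => Env.equal (ρ i) (ρ' i)) →
      Ent (fun i => rand (C i) (φ.realizers X (ρ i))) (fun i => φ.realizers X (ρ' i)))
    {ρ ρ' : I → Env X Γ} (h : Ent C (fun i => Env.equal (ρ i) (ρ' i))) :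
    Ent C (fun i => (Ty.omega.interp X).eq (φ.eval X (ρ i)) (φ.eval X (ρ' i))) :=
  (Ent.imp_intro (H _ _ h)).and_intro (Ent.imp_intro (H _ _ (Env.equal_symm h)))

/-- The interpretation of a term respects equality of environments. For `ρ = ρ'` this says that a
term denotes an existing element whenever its free variables do. -/
theorem Tm.congr (X : Eff) {Γ : Ctx} {a : Ty} (t : Tm Γ a) {I : Type} {C : I → Set ℕ}
    {ρ ρ' : I → Env X Γ} (h : Ent C (fun i => Env.equal (ρ i) (ρ' i))) :
    Ent C (fun i => (a.interp X).eq (t.eval X (ρ i)) (t.eval X (ρ' i))) := by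
  induction t generalizing I C with
  | var x => exact Env.equal_var x h
  | star => exact Ent.of_subset fun _ _ _ => rfl
  | pair s t ihs iht => exact (ihs h).and_intro (iht h)
  | @compr Γ b φ ih =>
    have key : ∀ ρ ρ' : I → Env X Γ, Ent C (fun i => Env.equal (ρ i) (ρ' i)) →
        Ent (fun p : I × (b.interp X).carrier =>
            rand (C p.1) (rand ((b.interp X).ex p.2) (φ.realizers X (Env.cons p.2 (ρ p.1)))))
          (fun p => rand ((b.interp X).ex p.2) (φ.realizers X (Env.cons p.2 (ρ' p.1)))) :=
      fun ρ ρ' h => Ent.and_intro (Ent.refl _).right.left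
        (omega_mp (X := X) (ih (Env.equal_cons ((h.wkIdx _).wk _) (Ent.refl _).right.left))
          (Ent.refl _).right.right)
    refine pow_eq_intro (X := b.interp X) (key ρ ρ' h) (key ρ' ρ (Env.equal_symm h))
      (Ent.refl _).right.left ?_
    -- Extensionality of the comprehension is the induction hypothesis along `ρ = ρ`.
    have hρ := Env.equal_trans h (Env.equal_symm h)
    refine Ent.and_intro ((b.interp X).ex_right (Ent.refl _).right.right) ?_
    exact omega_mp (X := X) (ih (Env.equal_cons ((hρ.wkIdx _).wk _) (Ent.refl _).right.right))
      (Ent.refl _).right.left.right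
  | @mem Γ b s t ihs iht =>
    refine omega_eq_of_transport (φ := .mem s t) (fun ρ ρ' h => ?_) h
    refine Ent.and_intro ((b.interp X).ex_right ((ihs h).wk _))
      (Ent.and_intro ((Ty.pow b).interp X |>.ex_right ((iht h).wk _)) ?_)
    exact pow_mp (X := b.interp X) ((iht h).wk _) _
      (pow_ext (X := b.interp X) (Ent.refl _).right.right.left (Ent.refl _).right.right.right
        ((ihs h).wk _))
  | @eq Γ b s t ihs iht =>
    refine omega_eq_of_transport (φ := .eq s t) (fun ρ ρ' h => ?_) h
    exact (b.interp X).eq_trans ((b.interp X).eq_symm ((ihs h).wk _))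
      ((b.interp X).eq_trans (Ent.refl _).right ((iht h).wk _))
  | top => exact omega_eq_of_transport (φ := .top) (fun ρ ρ' h => (Ent.refl _).right) h
  | bot => exact omega_eq_of_transport (φ := .bot) (fun ρ ρ' h => (Ent.refl _).right) h
  | and φ ψ ihφ ihψ =>
    exact omega_eq_of_transport (φ := .and φ ψ) (fun ρ ρ' h => Ent.and_intro
      (omega_mp (X := X) ((ihφ h).wk _) (Ent.refl _).right.left)
      (omega_mp (X := X) ((ihψ h).wk _) (Ent.refl _).right.right)) h
  | or φ ψ ihφ ihψ =>
    exact omega_eq_of_transport (φ := .or φ ψ) (fun ρ ρ' h => Ent.or_elim (Ent.refl _).right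
      (Ent.or_inl _ (omega_mp (X := X) (((ihφ h).wk _).wk _) (Ent.refl _).right))
      (Ent.or_inr _ (omega_mp (X := X) (((ihψ h).wk _).wk _) (Ent.refl _).right))) h
  | imp φ ψ ihφ ihψ =>
    exact omega_eq_of_transport (φ := .imp φ ψ) (fun ρ ρ' h => Ent.imp_intro
      (omega_mp (X := X) (((ihψ h).wk _).wk _) (Ent.mp (Ent.refl _).left.right
        (omega_mp (X := X) (((ihφ (Env.equal_symm h)).wk _).wk _) (Ent.refl _).right)))) h
  | @all Γ b φ ih =>
    refine omega_eq_of_transport (φ := .all φ) (fun ρ ρ' h => ?_) h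
    have hD := h.wk fun i => φ.all.realizers X (ρ i)
    let D := fun p : I × (b.interp X).carrier =>
      rand (rand (C p.1) (φ.all.realizers X (ρ p.1))) ((b.interp X).ex p.2)
    have e : Ent D (fun p => Env.equal (Env.cons p.2 (ρ p.1)) (Env.cons p.2 (ρ' p.1))) :=
      Env.equal_cons ((hD.wkIdx _).wk _) (Ent.and_right' _ _)
    have hφ : Ent D (fun p => φ.realizers X (Env.cons p.2 (ρ p.1))) :=
      Tm.all_elim (Ent.refl D).left.right (Ent.and_right' _ _)
    exact Tm.all_intro (omega_mp (X := X) (ih e) hφ)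
  | @ex Γ b φ ih =>
    refine omega_eq_of_transport (φ := .ex φ) (fun ρ ρ' h => ?_) h
    have hD := h.wk fun i => φ.ex.realizers X (ρ i)
    let D := fun p : I × (b.interp X).carrier => rand (rand (C p.1) (φ.ex.realizers X (ρ p.1)))
      (rand ((b.interp X).ex p.2) (φ.realizers X (Env.cons p.2 (ρ p.1))))
    have e : Ent D (fun p => Env.equal (Env.cons p.2 (ρ p.1)) (Env.cons p.2 (ρ' p.1))) :=
      Env.equal_cons ((hD.wkIdx _).wk _) (Ent.refl D).right.left
    have hφ : Ent D (fun p => φ.realizers X (Env.cons p.2 (ρ' p.1))) :=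
      omega_mp (X := X) (ih e) (Ent.refl D).right.right
    exact Tm.ex_elim (Ent.and_right' _ _) (Tm.ex_intro (Ent.refl D).right.left hφ)
  | zero => exact Ent.of_partrec _ Nat.Partrec.zero fun i m _ =>
      ⟨0, by exact Part.mem_some 0, rfl, rfl⟩
  | succ t ih =>
    refine (ih h).trans (Ent.of_partrec _ Nat.Partrec.succ ?_)
    rintro i _ ⟨rfl, h⟩
    exact ⟨_, Part.mem_some _, rfl, congrArg Nat.succ h⟩

/-! ### Soundness of higher-order intuitionistic logic -/

theorem Tm.ex_eval (X : Eff) {Γ : Ctx} {a : Ty} (t : Tm Γ a) {I : Type} {C : I → Set ℕ}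
    {ρ : I → Env X Γ} (h : Ent C (fun i => Env.equal (ρ i) (ρ i))) :
    Ent C (fun i => (a.interp X).ex (t.eval X (ρ i))) :=
  t.congr X h

theorem Tm.realizers_iff_intro {X : Eff} {Γ : Ctx} {φ ψ : Fm Γ} {I : Type} {C : I → Set ℕ}
    {ρ : I → Env X Γ}
    (h : Ent (fun i => rand (C i) (φ.realizers X (ρ i))) (fun i => ψ.realizers X (ρ i)))
    (h' : Ent (fun i => rand (C i) (ψ.realizers X (ρ i))) (fun i => φ.realizers X (ρ i))) :
    Ent C (fun i => (φ.iff ψ).realizers X (ρ i)) :=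
  (Ent.imp_intro h).and_intro (Ent.imp_intro h')

theorem Tm.mem_intro {X : Eff} {Γ : Ctx} {a : Ty} {s : Tm Γ a} {t : Tm Γ (.pow a)} {I : Type}
    {C : I → Set ℕ} {ρ : I → Env X Γ} (hρ : Ent C (fun i => Env.equal (ρ i) (ρ i)))
    (h : Ent C (fun i => (t.eval X (ρ i) : (a.interp X).carrier → Set ℕ) (s.eval X (ρ i)))) :
    Ent C (fun i => (Tm.mem s t).realizers X (ρ i)) :=
  (s.ex_eval X hρ).and_intro ((t.ex_eval X hρ).and_intro h)

/-- The last component of a realizer of `s ∈ t`; the others say that `s` and `t` exist. -/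
theorem Tm.mem_elim {X : Eff} {Γ : Ctx} {a : Ty} {s : Tm Γ a} {t : Tm Γ (.pow a)} {I : Type}
    {C : I → Set ℕ} {ρ : I → Env X Γ} (h : Ent C (fun i => (Tm.mem s t).realizers X (ρ i))) :
    Ent C (fun i => (t.eval X (ρ i) : (a.interp X).carrier → Set ℕ) (s.eval X (ρ i))) :=
  Ent.right (Ent.right h)

theorem Tm.mem_wk_intro {X : Eff} {Γ : Ctx} {a : Ty} {s : Tm Γ (.pow a)} {I : Type}
    {C : I → Set ℕ} {ρ : I → Env X Γ} {u : I → (a.interp X).carrier}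
    (hρ : Ent C (fun i => Env.equal (ρ i) (ρ i))) (hu : Ent C (fun i => (a.interp X).ex (u i)))
    (h : Ent C (fun i => (s.eval X (ρ i) : (a.interp X).carrier → Set ℕ) (u i))) :
    Ent C (fun i => (Tm.mem v0 s.wk).realizers X (Env.cons (u i) (ρ i))) :=
  Tm.mem_intro (Env.equal_cons hρ hu)
    (h.of_eq fun i => (congrFun (Tm.eval_wk X s (u i) (ρ i)) (u i)).symm)

theorem Tm.mem_wk_elim {X : Eff} {Γ : Ctx} {a : Ty} {s : Tm Γ (.pow a)} {I : Type}
    {C : I → Set ℕ} {ρ : I → Env X Γ} {u : I → (a.interp X).carrier}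
    (h : Ent C (fun i => (Tm.mem v0 s.wk).realizers X (Env.cons (u i) (ρ i)))) :
    Ent C (fun i => (s.eval X (ρ i) : (a.interp X).carrier → Set ℕ) (u i)) :=
  (Tm.mem_elim h).of_eq fun i => congrFun (Tm.eval_wk X s (u i) (ρ i)) (u i)

/-- Derivations are sound: if `φ` follows from `Φ` and `C` entails that the environment exists and
that `Φ` holds, then `C` entails that `φ` holds. The index set `I` and the hypothesis `C` are
arbitrary, so that the quantifier rules apply the induction hypothesis to a larger index set. -/
theorem Deriv.sound {X : Eff} {Ax : Set Sentence} (hAx : ∀ φ ∈ Ax, ValidIn X φ) {Γ : Ctx}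
    {Φ : List (Fm Γ)} {φ : Fm Γ} (d : Deriv Ax Γ Φ φ) {I : Type} {C : I → Set ℕ}
    {ρ : I → Env X Γ} (hρ : Ent C (fun i => Env.equal (ρ i) (ρ i)))
    (hΦ : ∀ ψ ∈ Φ, Ent C (fun i => ψ.realizers X (ρ i))) :
    Ent C (fun i => φ.realizers X (ρ i)) := by
  induction d generalizing I C with
  | @axm Γ Φ φ hφ =>
    -- An axiom has one realizer, whatever the environment.
    obtain ⟨n, hn⟩ := hAx φ hφ
    have e : ∀ i, φ.realizers X (Env.nil X) =
        Tm.realizers X (φ.rename (Δ := Γ) fun _ x => nomatch x) (ρ i) := fun i => by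
      rw [Tm.realizers, Tm.realizers, Tm.eval_rename]
      congr 1
      funext a x
      nomatch x
    exact Ent.of_partrec _ (Partrec.nat_iff.1 (Computable.const n)) fun i m _ =>
      ⟨n, Part.mem_some n, (e i).le hn⟩
  | hyp h => exact hΦ _ h
  | top_intro => exact Ent.top C
  | bot_elim _ ih =>
    refine Ent.trans (ih hρ hΦ) (Ent.of_subset fun i m hm => ?_)
    exact False.elim hm
  | and_intro _ _ ih ih' => exact (ih hρ hΦ).and_intro (ih' hρ hΦ)
  | and_left _ ih => exact Ent.left (ih hρ hΦ)
  | and_right _ ih => exact Ent.right (ih hρ hΦ)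
  | or_inl _ ih => exact Ent.or_inl _ (ih hρ hΦ)
  | or_inr _ ih => exact Ent.or_inr _ (ih hρ hΦ)
  | or_elim _ _ _ ih ih₁ ih₂ =>
    refine Ent.or_elim (ih hρ hΦ) (ih₁ (hρ.wk _) ?_) (ih₂ (hρ.wk _) ?_)
    all_goals
      refine List.forall_mem_cons.2 ⟨Ent.and_right' _ _, fun ψ hψ => (hΦ ψ hψ).wk _⟩
  | imp_intro _ ih =>
    exact Ent.imp_intro (ih (hρ.wk _)
      (List.forall_mem_cons.2 ⟨Ent.and_right' _ _, fun ψ hψ => (hΦ ψ hψ).wk _⟩))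
  | imp_elim _ _ ih ih' => exact Ent.mp (ih hρ hΦ) (ih' hρ hΦ)
  | @all_intro Γ Φ a φ _ ih =>
    refine Tm.all_intro (ih (Env.equal_cons ((hρ.wkIdx _).wk _) (Ent.and_right' _ _)) ?_)
    refine List.forall_mem_map.2 fun ψ hψ => ?_
    exact (((hΦ ψ hψ).wkIdx _).wk _).of_eq fun p => (Tm.eval_wk X ψ p.2 (ρ p.1)).symm
  | @all_elim Γ Φ a φ t _ ih =>
    exact (Tm.all_elim (ih hρ hΦ) (t.ex_eval X hρ)).of_eq fun i => (φ.eval_inst X t _).symm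
  | @ex_intro Γ Φ a φ t _ ih =>
    exact Tm.ex_intro (t.ex_eval X hρ) ((ih hρ hΦ).of_eq fun i => φ.eval_inst X t _)
  | @ex_elim Γ Φ a φ χ _ _ ih ih' =>
    refine Tm.ex_elim (ih hρ hΦ) (Ent.of_eq
      (ih' (Env.equal_cons ((hρ.wkIdx _).wk _) (Ent.left (Ent.and_right' _ _))) ?_)
      fun p => Tm.eval_wk X χ p.2 (ρ p.1))
    refine List.forall_mem_cons.2 ⟨Ent.right (Ent.and_right' _ _), ?_⟩
    refine List.forall_mem_map.2 fun ψ hψ => ?_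
    exact (((hΦ ψ hψ).wkIdx _).wk _).of_eq fun p => (Tm.eval_wk X ψ p.2 (ρ p.1)).symm
  | eq_refl t => exact t.ex_eval X hρ
  | @eq_subst Γ Φ a s t φ _ _ ih ih' =>
    exact Ent.of_eq (omega_mp (X := X) (φ.congr X (Env.equal_cons hρ (ih hρ hΦ)))
      ((ih' hρ hΦ).of_eq fun i => φ.eval_inst X s _)) fun i => (φ.eval_inst X t _).symm
  | @comprehension Γ Φ a φ t =>
    refine Tm.realizers_iff_intro ?_ ?_
    · exact (Ent.right (Ent.right (Ent.right (Ent.and_right' _ _)))).of_eq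
        fun i => (φ.eval_inst X t _).symm
    · refine Tm.mem_intro (hρ.wk _) (Ent.and_intro ((t.ex_eval X hρ).wk _) ?_)
      exact (Ent.and_right' _ _).of_eq fun i => φ.eval_inst X t _
  | @set_ext Γ Φ a s t _ ih =>
    let D := fun (r : Tm Γ (.pow a)) (p : I × (a.interp X).carrier) =>
      rand (C p.1) ((r.eval X (ρ p.1) : (a.interp X).carrier → Set ℕ) p.2)
    have hx : ∀ r, Ent (D r) (fun p => (a.interp X).ex p.2) := fun r =>
      pow_strict (((r.ex_eval X hρ).wkIdx _).wk _) (fun p => p.2) (Ent.and_right' _ _)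
    have hr : ∀ r, Ent (D r) (fun p => (Tm.mem v0 r.wk).realizers X (Env.cons p.2 (ρ p.1))) :=
      fun r => Tm.mem_wk_intro ((hρ.wkIdx _).wk _) (hx r) (Ent.and_right' _ _)
    have hiff : ∀ r, Ent (D r) (fun p =>
        (Tm.iff (Tm.mem v0 s.wk) (Tm.mem v0 t.wk)).realizers X (Env.cons p.2 (ρ p.1))) :=
      fun r => Tm.all_elim (((ih hρ hΦ).wkIdx _).wk _) (hx r)
    exact pow_eq_of_ex (s.ex_eval X hρ) (Tm.mem_wk_elim ((Ent.left (hiff s)).mp (hr s)))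
      (Tm.mem_wk_elim ((Ent.right (hiff t)).mp (hr t)))
  | prop_ext _ ih => exact ih hρ hΦ
  | unit_eta t => exact Ent.of_subset fun _ _ _ => rfl
  | @pair_surj Γ Φ a b t =>
    have ht := t.ex_eval X hρ
    refine Tm.ex_intro (u := fun i => (t.eval X (ρ i)).1) (Ent.left ht)
      (Tm.ex_intro (u := fun i => (t.eval X (ρ i)).2) (Ent.right ht) (ht.of_eq fun i => ?_))
    exact congrArg (fun u => ((Ty.prod a b).interp X).eq u (t.eval X (ρ i)))
      (((Tm.eval_wk X t.wk _ _).trans (Tm.eval_wk X t _ _)).symm)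
  | pair_inj_left _ ih => exact Ent.left (ih hρ hΦ)
  | pair_inj_right _ ih => exact Ent.right (ih hρ hΦ)
  | succ_ne_zero t =>
    refine Ent.imp_intro (Ent.trans (Ent.and_right' _ _) (Ent.of_subset fun i m hm => ?_))
    exact absurd hm.2 (Nat.succ_ne_zero _)
  | @succ_inj Γ Φ s t _ ih =>
    have hpred : Nat.Partrec fun n => Part.some n.pred :=
      Partrec.nat_iff.1 Primrec.pred.to_comp
    refine Ent.trans (ih hρ hΦ) (Ent.of_partrec _ hpred fun i m hm => ?_)
    refine ⟨_, Part.mem_some _, ?_, Nat.succ.inj hm.2⟩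
    exact congrArg Nat.pred hm.1
  | @induction Γ Φ s _ _ ih ih' =>
    let P := fun (i : I) (n : ℕ) => (s.eval X (ρ i) : ℕ → Set ℕ) n
    let D := fun p : I × ℕ => rand (rand (C p.1) (Eff.nat.ex p.2)) (P p.1 p.2)
    have hD : Ent D (fun p => Eff.nat.ex p.2) := (Ent.and_right' _ _).wk _
    have hρD : Ent D (fun p => Env.equal (ρ p.1) (ρ p.1)) := ((hρ.wkIdx _).wk _).wk _
    have hstep : Ent D (fun p => (Tm.imp (Tm.mem v0 s.wk) (Tm.mem v0.succ s.wk)).realizers X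
        (Env.cons (b := .nat) p.2 (ρ p.1))) :=
      Tm.all_elim (b := .nat) ((((ih' hρ hΦ).wkIdx _).wk _).wk _) hD
    have hsucc : Ent D (fun p => (Tm.mem v0.succ s.wk).realizers X
        (Env.cons (b := .nat) p.2 (ρ p.1))) :=
      hstep.mp (Tm.mem_wk_intro hρD hD (Ent.and_right' _ _))
    have hind := Ent.nat_induction (P := P) (Tm.mem_elim (ih hρ hΦ))
      ((Tm.mem_elim hsucc).of_eq fun p => congrFun (Tm.eval_wk X s _ _) _)
    exact Tm.all_intro (Tm.mem_wk_intro ((hρ.wkIdx _).wk _) (Ent.and_right' _ _) hind)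

/-! ### Dependent Choice -/

theorem validIn_of_ent {X : Eff} {φ : Sentence}
    (h : Ent (fun _ : Unit => Set.univ) (fun _ => φ.realizers X (Env.nil X))) : ValidIn X φ := by
  obtain ⟨n, hn⟩ := h
  obtain ⟨k, -, hk⟩ := hn () 0 trivial
  exact ⟨k, hk⟩

/-- Realized equality of natural numbers is actual equality, so every predicate respects it. -/
theorem nat_subst {I : Type} {C : I → Set ℕ} {P : I → ℕ → Set ℕ} {m n : I → ℕ}
    (h : Ent C (fun i => Eff.nat.eq (m i) (n i))) (h' : Ent C (fun i => P i (m i))) :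
    Ent C (fun i => P i (n i)) := by
  refine (h.and_intro h').trans (Ent.of_partrec _ Nat.Partrec.right fun i k hk => ?_)
  obtain ⟨a, ha, b, hb, rfl⟩ := hk
  refine ⟨b, by simp, ?_⟩
  have e : m i = n i := ha.2
  exact e ▸ hb

/-- The realizers of a membership formula, for an existing set, given those of the predicate. -/
theorem mem_of_pow {X : Eff} {I : Type} {C : I → Set ℕ} {A : I → X.carrier → Set ℕ}
    (h : Ent C (fun i => X.pow.ex (A i))) {x : I → X.carrier} (h' : Ent C (fun i => A i (x i))) :
    Ent C (fun i => rand (X.ex (x i)) (rand (X.pow.ex (A i)) (A i (x i)))) :=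
  (pow_strict h x h').and_intro (h.and_intro h')

/-- The graph of a sequence of elements of `X`, as a subobject of `ℕ × X`. The sequence need not be
computable: only realizers of the existence of its members have to be. -/
def seqGraph (X : Eff) (y : ℕ → X.carrier) : (Eff.nat.prod X).carrier → Set ℕ :=
  fun q => rand (Eff.nat.ex q.1) (X.eq (y q.1) q.2)

/-- The realizer does not depend on the sequence. -/
theorem seqGraph_ex (X : Eff) {I : Type} {C : I → Set ℕ} (y : I → ℕ → X.carrier) :
    Ent C (fun i => (Eff.nat.prod X).pow.ex (seqGraph X (y i))) := by
  refine pow_eq_intro (Ent.and_right' _ _) (Ent.and_right' _ _) ?_ ?_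
  · exact Ent.and_intro (Ent.left (Ent.and_right' _ _))
      (X.ex_right (Ent.right (Ent.and_right' _ _)))
  · let D := fun p : I × (ℕ × X.carrier) × (ℕ × X.carrier) =>
      rand (C p.1) (rand (seqGraph X (y p.1) p.2.1) ((Eff.nat.prod X).eq p.2.1 p.2.2))
    have hn : Ent D (fun p => Eff.nat.eq p.2.1.1 p.2.2.1) := (Ent.refl D).right.right.left
    have ht : Ent D (fun p => X.eq p.2.1.2 p.2.2.2) := (Ent.refl D).right.right.right
    have hy : Ent D (fun p => X.eq (y p.1 p.2.1.1) p.2.1.2) := (Ent.refl D).right.left.right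
    exact Ent.and_intro (Eff.nat.ex_right hn)
      (nat_subst (P := fun (p : I × (ℕ × X.carrier) × (ℕ × X.carrier)) n =>
        X.eq (y p.1 n) p.2.2.2) hn (X.eq_trans hy ht))

/-- The body of the conclusion of dependent choice: a sequence in `S` that starts at `x` and whose
consecutive members are related by `R` satisfies it. -/
theorem dependentChoice_conclusion {X : Eff} {a : Ty} {K : Type} {D : K → Set ℕ}
    {S : K → (a.interp X).carrier → Set ℕ}
    {R : K → (a.interp X).carrier × (a.interp X).carrier → Set ℕ}
    {x : K → (a.interp X).carrier} {y : K → ℕ → (a.interp X).carrier}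
    (hS : Ent D (fun k => (a.interp X).pow.ex (S k)))
    (hR : Ent D (fun k => ((a.interp X).prod (a.interp X)).pow.ex (R k)))
    (hx : Ent D (fun k => (a.interp X).ex (x k))) (h0 : ∀ k, (D k).Nonempty → y k 0 = x k)
    (hy : Ent (fun p : K × ℕ => rand (D p.1) (Eff.nat.ex p.2))
      (fun p => rand (rand ((a.interp X).ex (y p.1 p.2)) (S p.1 (y p.1 p.2)))
        (R p.1 (y p.1 p.2, y p.1 (p.2 + 1))))) :
    Ent D (fun k => Tm.realizers X
      (((isFun v0).and (rel v0 .zero v1)).and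
        ((((rel v2 v1 v0).imp (Tm.mem v0 v5)).all.all).and
          (((rel v3 v2 v1).and (rel v3 v2.succ v0)).imp (rel v5 v1 v0)).all.all.all))
      (Env.cons (b := .pow (.prod .nat a)) (seqGraph (a.interp X) (y k)) (Env.cons (x k)
        (Env.cons (b := .pow (.prod a a)) (R k) (Env.cons (b := .pow a) (S k) (Env.nil X)))))) := by
  let A := a.interp X
  have hF : ∀ {J : Type} {E : J → Set ℕ} (k : J → K),
      Ent E (fun j => (Eff.nat.prod A).pow.ex (seqGraph A (y (k j)))) := fun k => seqGraph_ex A _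
  refine Ent.and_intro (Ent.and_intro (Ent.and_intro ?_ ?_) ?_) (Ent.and_intro ?_ ?_)
  · refine Tm.all_intro ?_
    refine Tm.ex_intro (u := fun p => y p.1 p.2) (Ent.left (Ent.left hy)) ?_
    exact mem_of_pow (hF _) ((Ent.and_right' _ _).and_intro (Ent.left (Ent.left hy)))
  · refine Tm.all_intro (Tm.all_intro (Tm.all_intro (Ent.imp_intro ?_)))
    refine Ent.trans (Ent.and_right' _ _) ?_
    exact A.eq_trans (A.eq_symm (Ent.refl _).left.right.right.right)
      (Ent.refl _).right.right.right.right
  · have hz : Ent D (fun _ => Eff.nat.ex (0 : ℕ)) :=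
      Ent.of_partrec _ Nat.Partrec.zero fun k m _ => ⟨0, by exact Part.mem_some 0, rfl, rfl⟩
    have hyx : Ent D (fun k => A.eq (y k 0) (x k)) := by
      obtain ⟨n, hn⟩ := hx
      refine ⟨n, fun k m hm => ?_⟩
      change ∃ j ∈ app n m, j ∈ A.eq (y k 0) (x k)
      rw [h0 k ⟨m, hm⟩]
      exact hn k m hm
    exact mem_of_pow (hF _) (hz.and_intro hyx)
  · refine Tm.all_intro (Tm.all_intro (Ent.imp_intro ?_))
    let E := fun p : (K × ℕ) × A.carrier =>
      rand (rand (rand (D p.1.1) (Eff.nat.ex p.1.2)) (A.ex p.2))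
        (rand ((Eff.nat.prod A).ex (p.1.2, p.2))
          (rand ((Eff.nat.prod A).pow.ex (seqGraph A (y p.1.1)))
            (seqGraph A (y p.1.1) (p.1.2, p.2))))
    have hSE : Ent E (fun p => A.pow.ex (S p.1.1)) :=
      (Ent.refl E).left.left.left.trans (hS.reindex fun p : (K × ℕ) × A.carrier => p.1.1)
    have hyE : Ent E (fun p => S p.1.1 (y p.1.1 p.1.2)) :=
      (Ent.refl E).left.left.trans (hy.left.right.reindex fun p : (K × ℕ) × A.carrier => p.1)
    have hseq : Ent E (fun p => A.eq (y p.1.1 p.1.2) p.2) := (Ent.refl E).right.right.right.right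
    exact mem_of_pow hSE (pow_ext hSE hyE hseq)
  · refine Tm.all_intro (Tm.all_intro (Tm.all_intro (Ent.imp_intro ?_)))
    let E := fun p : ((K × ℕ) × A.carrier) × A.carrier =>
      rand (rand (rand (rand (D p.1.1.1) (Eff.nat.ex p.1.1.2)) (A.ex p.1.2)) (A.ex p.2))
        (rand
          (rand ((Eff.nat.prod A).ex (p.1.1.2, p.1.2))
            (rand ((Eff.nat.prod A).pow.ex (seqGraph A (y p.1.1.1)))
              (seqGraph A (y p.1.1.1) (p.1.1.2, p.1.2))))
          (rand ((Eff.nat.prod A).ex (p.1.1.2 + 1, p.2))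
            (rand ((Eff.nat.prod A).pow.ex (seqGraph A (y p.1.1.1)))
              (seqGraph A (y p.1.1.1) (p.1.1.2 + 1, p.2)))))
    have hRE : Ent E (fun p => (A.prod A).pow.ex (R p.1.1.1)) :=
      (Ent.refl E).left.left.left.left.trans
        (hR.reindex fun p : ((K × ℕ) × A.carrier) × A.carrier => p.1.1.1)
    have hyE : Ent E (fun p => R p.1.1.1 (y p.1.1.1 p.1.1.2, y p.1.1.1 (p.1.1.2 + 1))) :=
      (Ent.refl E).left.left.left.trans
        (hy.right.reindex fun p : ((K × ℕ) × A.carrier) × A.carrier => p.1.1)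
    have hseq : Ent E (fun p => A.eq (y p.1.1.1 p.1.1.2) p.1.2) :=
      (Ent.refl E).right.left.right.right.right
    have hseq' : Ent E (fun p => A.eq (y p.1.1.1 (p.1.1.2 + 1)) p.2) :=
      (Ent.refl E).right.right.right.right.right
    exact mem_of_pow hRE (pow_ext hRE hyE (hseq.and_intro hseq'))

/-- The realizers of the hypothesis of dependent choice, unfolded. -/
theorem dependentChoice_step {X : Eff} {a : Ty} {I : Type} {C : I → Set ℕ}
    {S : I → (a.interp X).carrier → Set ℕ}
    {R : I → (a.interp X).carrier × (a.interp X).carrier → Set ℕ}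
    (hS : Ent C (fun i => (a.interp X).pow.ex (S i)))
    (h : Ent C (fun i => Tm.realizers X
      ((Tm.mem v0 v2).imp ((Tm.mem v0 v3).and (rel v2 v1 v0)).ex).all
      (Env.cons (b := .pow (.prod a a)) (R i) (Env.cons (b := .pow a) (S i) (Env.nil X))))) :
    Ent (fun p : I × (a.interp X).carrier =>
        rand (C p.1) (rand ((a.interp X).ex p.2) (S p.1 p.2)))
      (fun p => ⋃ y, rand (rand ((a.interp X).ex y) (S p.1 y)) (R p.1 (p.2, y))) := by
  let D := fun p : I × (a.interp X).carrier =>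
    rand (C p.1) (rand ((a.interp X).ex p.2) (S p.1 p.2))
  have hx : Ent D (fun p => (a.interp X).ex p.2) := (Ent.refl D).right.left
  have hmem := mem_of_pow (A := fun p : I × (a.interp X).carrier => S p.1) (x := fun p => p.2)
    ((hS.wkIdx _).wk _) (Ent.refl D).right.right
  refine Tm.ex_elim (Ent.mp (Tm.all_elim ((h.wkIdx _).wk _) hx) hmem) ?_
  refine Ent.ex_and_intro (fun p => p.2) (Ent.and_intro (Ent.refl _).right.left ?_) ?_
  · exact (Ent.refl _).right.right.left.right.right
  · exact (Ent.refl _).right.right.right.right.right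

/-- The choice of a sequence in the internal language, from the hypotheses of dependent choice. -/
theorem dependentChoice_seq {X : Eff} {a : Ty} {I : Type} {C : I → Set ℕ}
    {S : I → (a.interp X).carrier → Set ℕ}
    {R : I → (a.interp X).carrier × (a.interp X).carrier → Set ℕ} {x : I → (a.interp X).carrier}
    (hS : Ent C (fun i => (a.interp X).pow.ex (S i)))
    (hR : Ent C (fun i => ((a.interp X).prod (a.interp X)).pow.ex (R i)))
    (hx : Ent C (fun i => (a.interp X).ex (x i))) (hxS : Ent C (fun i => S i (x i)))
    (h : Ent C (fun i => Tm.realizers X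
      ((Tm.mem v0 v2).imp ((Tm.mem v0 v3).and (rel v2 v1 v0)).ex).all
      (Env.cons (b := .pow (.prod a a)) (R i) (Env.cons (b := .pow a) (S i) (Env.nil X))))) :
    Ent C (fun i => Tm.realizers X
      (Tm.ex (a := .pow (.prod .nat a)) (((isFun v0).and (rel v0 .zero v1)).and
        ((((rel v2 v1 v0).imp (Tm.mem v0 v5)).all.all).and
          (((rel v3 v2 v1).and (rel v3 v2.succ v0)).imp (rel v5 v1 v0)).all.all.all)))
      (Env.cons (x i)
        (Env.cons (b := .pow (.prod a a)) (R i) (Env.cons (b := .pow a) (S i) (Env.nil X))))) := by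
  have hseq := Ent.dependent_choice
    (E := fun i t => rand ((a.interp X).ex t) (S i t)) (Q := fun i t u => R i (t, u)) x
    (hx.and_intro hxS) (dependentChoice_step hS h)
  refine Ent.ex_elim hseq ?_
  let D := fun p : I × (ℕ → (a.interp X).carrier) => rand (C p.1) (rand {_n | p.2 0 = x p.1}
    (⋂ n : ℕ, rimp (Eff.nat.ex n)
      (rand (rand ((a.interp X).ex (p.2 n)) (S p.1 (p.2 n))) (R p.1 (p.2 n, p.2 (n + 1))))))
  have hSD : Ent D (fun p => (a.interp X).pow.ex (S p.1)) := (hS.wkIdx _).wk _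
  have hRD : Ent D (fun p => ((a.interp X).prod (a.interp X)).pow.ex (R p.1)) := (hR.wkIdx _).wk _
  have hxD : Ent D (fun p => (a.interp X).ex (x p.1)) := (hx.wkIdx _).wk _
  have hseqD : Ent D (fun p => (Eff.nat.prod (a.interp X)).pow.ex
    (seqGraph (a.interp X) p.2)) := seqGraph_ex (C := D) (a.interp X) fun p => p.2
  refine Tm.ex_intro (b := .pow (.prod .nat a)) hseqD (dependentChoice_conclusion hSD hRD hxD ?_ ?_)
  · rintro p ⟨_, _, _, _, ⟨_, h, _⟩, _⟩
    exact h
  · have hD : Ent D (fun p => ⋂ n : ℕ, rimp (Eff.nat.ex n)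
        (rand (rand ((a.interp X).ex (p.2 n)) (S p.1 (p.2 n))) (R p.1 (p.2 n, p.2 (n + 1))))) :=
      (Ent.refl D).right.right
    exact Ent.all_mp ((hD.wkIdx ℕ).wk _) (fun p => p.2) (Ent.and_right' _ _)

theorem dependentChoice_valid (X : Eff) (a : Ty) : ValidIn X (dependentChoice a) := by
  refine validIn_of_ent (Tm.all_intro (Tm.all_intro (Ent.imp_intro
    (Tm.all_intro (Ent.imp_intro ?_)))))
  exact dependentChoice_seq (Ent.refl _).left.left.left.left.right (Ent.refl _).left.left.left.right
    (Ent.refl _).left.right (Tm.mem_elim (Ent.and_right' _ _)) (Ent.refl _).left.left.right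

end HOL

namespace Realizability

/-! ### Uniform non-standard predicates -/

theorem nonempty_of_rimp {A B : Set ℕ} (h : (rimp A B).Nonempty)
    (h' : A.Nonempty) : B.Nonempty := by
  obtain ⟨n, hn⟩ := h
  obtain ⟨m, hm⟩ := h'
  obtain ⟨k, -, hk⟩ := hn m hm
  exact ⟨k, hk⟩

theorem nonempty_rand {A B : Set ℕ} (h : A.Nonempty) (h' : B.Nonempty) :
    (rand A B).Nonempty :=
  let ⟨m, hm⟩ := h
  let ⟨n, hn⟩ := h'
  ⟨_, m, hm, n, hn, rfl⟩

/-- A non-standard predicate is uniform with truth value `P` if it is realized only where `P` holds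
and one number realizes it wherever `P` holds. A realizer then carries no information beyond the
truth of `P`. -/
def Uniform {I : Type} (A : I → Set ℕ) (P : I → Prop) : Prop :=
  (∀ i, (A i).Nonempty → P i) ∧ ∃ n, ∀ i, P i → n ∈ A i

namespace Uniform

variable {I : Type} {A B : I → Set ℕ} {P Q : I → Prop}

theorem nonempty (h : Uniform A P) {i : I} (hi : P i) : (A i).Nonempty :=
  let ⟨n, hn⟩ := h.2
  ⟨n, hn i hi⟩

theorem nonempty_iff (h : Uniform A P) (i : I) : (A i).Nonempty ↔ P i := ⟨h.1 i, h.nonempty⟩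

theorem congr (h : Uniform A P) (e : ∀ i, P i ↔ Q i) : Uniform A Q :=
  ⟨fun i hi => (e i).1 (h.1 i hi), h.2.imp fun _ hn i hi => hn i ((e i).2 hi)⟩

theorem prop (P : I → Prop) : Uniform (fun i => {_n | P i}) P :=
  ⟨fun _ ⟨_, h⟩ => h, 0, fun _ h => h⟩

theorem bot : Uniform (fun _ : I => (∅ : Set ℕ)) (fun _ => False) :=
  ⟨fun _ ⟨_, h⟩ => h, 0, fun _ h => h.elim⟩

theorem and (h : Uniform A P) (h' : Uniform B Q) :
    Uniform (fun i => rand (A i) (B i)) (fun i => P i ∧ Q i) := by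
  refine ⟨fun i ⟨_, m, hm, n, hn, _⟩ => ⟨h.1 i ⟨m, hm⟩, h'.1 i ⟨n, hn⟩⟩, ?_⟩
  obtain ⟨m, hm⟩ := h.2
  obtain ⟨n, hn⟩ := h'.2
  exact ⟨Nat.pair m n, fun i hi => ⟨m, hm i hi.1, n, hn i hi.2, rfl⟩⟩

theorem exists_const (n : ℕ) : ∃ e, ∀ m, n ∈ app e m :=
  ⟨Encodable.encode (Nat.Partrec.Code.const n), fun m => by simp [app]⟩

/-- Implications with a uniform conclusion are uniform, whatever the hypothesis. -/
theorem imp (h : Uniform B Q) : Uniform (fun i => rimp (A i) (B i))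
    (fun i => (A i).Nonempty → Q i) := by
  refine ⟨fun i ⟨n, hn⟩ ⟨m, hm⟩ => ?_, ?_⟩
  · obtain ⟨k, -, hk⟩ := hn m hm
    exact h.1 i ⟨k, hk⟩
  · obtain ⟨n, hn⟩ := h.2
    obtain ⟨e, he⟩ := exists_const n
    exact ⟨e, fun i hi m hm => ⟨n, he m, hn i (hi ⟨m, hm⟩)⟩⟩

theorem iInter_imp {J : Type} {D B : I → J → Set ℕ} {Q : I × J → Prop}
    (h : Uniform (fun p : I × J => B p.1 p.2) Q) :
    Uniform (fun i => ⋂ j, rimp (D i j) (B i j)) (fun i => ∀ j, (D i j).Nonempty → Q (i, j)) := by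
  have h' := h.imp (A := fun p => D p.1 p.2)
  refine ⟨fun i ⟨n, hn⟩ j => h'.1 (i, j) ⟨n, Set.mem_iInter.1 hn j⟩, ?_⟩
  obtain ⟨n, hn⟩ := h'.2
  exact ⟨n, fun i hi => Set.mem_iInter.2 fun j => hn (i, j) (hi j)⟩

/-- Uniformity survives an existential quantifier as the realizers do not mention the witness. -/
theorem iUnion {J : Type} {B : I → J → Set ℕ} {Q : I × J → Prop}
    (h : Uniform (fun p : I × J => B p.1 p.2) Q) :
    Uniform (fun i => ⋃ j, B i j) (fun i => ∃ j, Q (i, j)) := by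
  refine ⟨fun i ⟨n, hn⟩ => ?_, ?_⟩
  · obtain ⟨j, hj⟩ := Set.mem_iUnion.1 hn
    exact ⟨j, h.1 (i, j) ⟨n, hj⟩⟩
  · obtain ⟨n, hn⟩ := h.2
    exact ⟨n, fun i ⟨j, hj⟩ => Set.mem_iUnion.2 ⟨j, hn (i, j) hj⟩⟩

/-- A predicate equivalent to one that is `ℕ` or `∅` everywhere is uniform: the program that
realizes the equivalence has a single value at `0`. -/
theorem of_ent (h : Ent A (fun i => {_n | P i})) (h' : Ent (fun i => {_n | P i}) A) :
    Uniform A P := by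
  obtain ⟨m, hm⟩ := h
  obtain ⟨n, hn⟩ := h'
  refine ⟨fun i ⟨a, ha⟩ => (hm i a ha).choose_spec.2, ?_⟩
  by_cases hP : ∃ i, P i
  · obtain ⟨i, hi⟩ := hP
    obtain ⟨k, hk, -⟩ := hn i 0 hi
    refine ⟨k, fun j hj => ?_⟩
    obtain ⟨l, hl, hl'⟩ := hn j 0 hj
    exact Part.mem_unique hl hk ▸ hl'
  · exact ⟨0, fun i hi => (hP ⟨i, hi⟩).elim⟩

end Uniform

end Realizability

namespace HOL

/-! ### Internal order theory of constant objects -/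

/-- Every non-standard predicate on a product of constant objects exists as a subset. -/
theorem nabla_pow_ex_nonempty {S T : Type} (A : S × T → Set ℕ) :
    (((Eff.nablaObj S).prod (Eff.nablaObj T)).pow.ex A).Nonempty := by
  have h : Ent (fun _ : Unit => Set.univ)
      (fun _ => ((Eff.nablaObj S).prod (Eff.nablaObj T)).pow.ex A) := by
    refine pow_eq_intro (Ent.and_right' _ _) (Ent.and_right' _ _)
      ((Ent.of_subset fun _ _ _ => rfl).and_intro (Ent.of_subset fun _ _ _ => rfl)) ?_
    refine (Ent.and_right' _ _).trans (Ent.of_partrec _ Nat.Partrec.left ?_)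
    rintro ⟨_, p, q⟩ _ ⟨a, ha, b, ⟨_, e₁, _, e₂, _⟩, rfl⟩
    obtain rfl : p = q := Prod.ext e₁ e₂
    exact ⟨a, by simp, ha⟩
  obtain ⟨n, hn⟩ := h
  obtain ⟨k, -, hk⟩ := hn () 0 trivial
  exact ⟨k, hk⟩

section Formulas

variable {S : Type} {Γ : Ctx} {I : Type} {ρ : I → Env (Eff.nablaObj S) Γ}

theorem uniform_and {φ ψ : Fm Γ} {P Q : I → Prop}
    (h : Uniform (fun i => φ.realizers (Eff.nablaObj S) (ρ i)) P)
    (h' : Uniform (fun i => ψ.realizers (Eff.nablaObj S) (ρ i)) Q) :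
    Uniform (fun i => (φ.and ψ).realizers (Eff.nablaObj S) (ρ i)) (fun i => P i ∧ Q i) :=
  h.and h'

theorem uniform_imp {φ ψ : Fm Γ} {P Q : I → Prop}
    (h : Uniform (fun i => φ.realizers (Eff.nablaObj S) (ρ i)) P)
    (h' : Uniform (fun i => ψ.realizers (Eff.nablaObj S) (ρ i)) Q) :
    Uniform (fun i => (φ.imp ψ).realizers (Eff.nablaObj S) (ρ i)) (fun i => P i → Q i) :=
  h'.imp.congr fun i => by rw [h.nonempty_iff]

/-- Every element of a constant object exists, so the quantifier is not restricted. -/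
theorem uniform_all {φ : Fm (.base :: Γ)} {Q : I × S → Prop}
    (h : Uniform (fun p : I × S =>
      φ.realizers (Eff.nablaObj S) (Env.cons (b := .base) p.2 (ρ p.1))) Q) :
    Uniform (fun i => φ.all.realizers (Eff.nablaObj S) (ρ i)) (fun i => ∀ u, Q (i, u)) :=
  (Uniform.iInter_imp (D := fun _ u => (Eff.nablaObj S).ex u) h).congr fun _ =>
    ⟨fun h u => h u ⟨0, rfl⟩, fun h u _ => h u⟩

theorem uniform_ex {φ : Fm (.base :: Γ)} {Q : I × S → Prop}
    (h : Uniform (fun p : I × S =>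
      φ.realizers (Eff.nablaObj S) (Env.cons (b := .base) p.2 (ρ p.1))) Q) :
    Uniform (fun i => φ.ex.realizers (Eff.nablaObj S) (ρ i)) (fun i => ∃ u, Q (i, u)) :=
  (Uniform.iUnion (((Uniform.prop fun p : I × S => p.2 = p.2)).and h)).congr fun _ =>
    ⟨fun ⟨u, h⟩ => ⟨u, h.2⟩, fun ⟨u, h⟩ => ⟨u, rfl, h⟩⟩

/-- The term `r` denotes, in all environments `ρ i`, the same subobject of the square of the ground
type, and this subobject is uniform with truth value `Q`. -/
def IsUniformRel (ρ : I → Env (Eff.nablaObj S) Γ) (r : Tm Γ (.pow (.prod .base .base)))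
    (Q : S → S → Prop) : Prop :=
  ∃ A : S × S → Set ℕ, (∀ i, r.eval (Eff.nablaObj S) (ρ i) = A) ∧
    Uniform A (fun p => Q p.1 p.2)

theorem IsUniformRel.wk {r : Tm Γ (.pow (.prod .base .base))} {Q : S → S → Prop} {b : Ty}
    (h : IsUniformRel ρ r Q) :
    IsUniformRel (fun p : I × (b.interp (Eff.nablaObj S)).carrier => Env.cons p.2 (ρ p.1))
      r.wk Q :=
  let ⟨A, hA, hQ⟩ := h
  ⟨A, fun p => (Tm.eval_wk _ r p.2 (ρ p.1)).trans (hA p.1), hQ⟩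

theorem uniform_eq {s t : Tm Γ .base} : Uniform (fun i => (s.eq t).realizers (Eff.nablaObj S) (ρ i))
    (fun i => s.eval (Eff.nablaObj S) (ρ i) = t.eval (Eff.nablaObj S) (ρ i)) :=
  Uniform.prop _

theorem IsUniformRel.rel_of_eval {r : Tm Γ (.pow (.prod .base .base))} {Q : S → S → Prop}
    (h : IsUniformRel ρ r Q) {s t : Tm Γ .base} {x y : I → S}
    (hs : ∀ i, s.eval (Eff.nablaObj S) (ρ i) = x i)
    (ht : ∀ i, t.eval (Eff.nablaObj S) (ρ i) = y i) :
    Uniform (fun i => (HOL.rel r s t).realizers (Eff.nablaObj S) (ρ i))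
      (fun i => Q (x i) (y i)) := by
  obtain ⟨A, hA, hQ, n, hn⟩ := h
  have e : ∀ i, (HOL.rel r s t).realizers (Eff.nablaObj S) (ρ i) =
      rand (((Eff.nablaObj S).prod (Eff.nablaObj S)).ex (x i, y i))
        (rand (((Eff.nablaObj S).prod (Eff.nablaObj S)).pow.ex A) (A (x i, y i))) := fun i => by
    rw [← hA i, ← hs i, ← ht i]
    rfl
  simp only [e]
  obtain ⟨k, hk⟩ := nabla_pow_ex_nonempty A
  refine ⟨fun i ⟨_, _, _, _, ⟨_, _, a, ha, _⟩, _⟩ => hQ _ ⟨a, ha⟩, ?_⟩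
  exact ⟨Nat.pair (Nat.pair 0 0) (Nat.pair k n), fun i hi =>
    ⟨_, ⟨0, rfl, 0, rfl, rfl⟩, _, ⟨k, hk, n, hn _ hi, rfl⟩, rfl⟩⟩

theorem IsUniformRel.rel {r : Tm Γ (.pow (.prod .base .base))} {Q : S → S → Prop}
    (h : IsUniformRel ρ r Q) (s t : Tm Γ .base) :
    Uniform (fun i => (HOL.rel r s t).realizers (Eff.nablaObj S) (ρ i))
      (fun i => Q (s.eval (Eff.nablaObj S) (ρ i)) (t.eval (Eff.nablaObj S) (ρ i))) :=
  h.rel_of_eval (fun _ => rfl) (fun _ => rfl)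

end Formulas

section Order

variable {S : Type} {Γ : Ctx} {I : Type} {ρ : I → Env (Eff.nablaObj S) Γ}
  {le : Tm Γ (.pow (.prod .base .base))}

/-- The value of a weakened term, in the form used for formulas under a quantifier. -/
theorem eval_wk_of_eval {X : Eff} {J : Type} {Δ : Ctx} {η : J → Env X Δ} {a b : Ty} {t : Tm Δ a}
    {x : J → (a.interp X).carrier} (h : ∀ j, t.eval X (η j) = x j)
    (p : J × (b.interp X).carrier) : t.wk.eval X (Env.cons p.2 (η p.1)) = x p.1 :=
  (Tm.eval_wk X t p.2 (η p.1)).trans (h p.1)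

theorem uniform_isPoset [PartialOrder S] (h : IsUniformRel ρ le (· ≤ ·)) :
    Uniform (fun i => (isPoset le).realizers (Eff.nablaObj S) (ρ i)) (fun _ => True) := by
  refine (uniform_and (uniform_all (h.wk.rel v0 v0)) (uniform_and
    (uniform_all (uniform_all (uniform_all (uniform_imp
      (uniform_and (h.wk.wk.wk.rel v2 v1) (h.wk.wk.wk.rel v1 v0)) (h.wk.wk.wk.rel v2 v0)))))
    (uniform_all (uniform_all (uniform_imp
      (uniform_and (h.wk.wk.rel v1 v0) (h.wk.wk.rel v0 v1))
      uniform_eq))))).congr fun i => iff_true_intro ?_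
  exact ⟨fun x => le_refl (α := S) x, fun x y z h => le_trans (α := S) h.1 h.2,
    fun x y h => le_antisymm (α := S) h.1 h.2⟩

theorem uniform_isGlb_of_eval [Lattice S] (h : IsUniformRel ρ le (· ≤ ·)) {m x y : Tm Γ .base}
    {m' x' y' : I → S} (hm : ∀ i, m.eval (Eff.nablaObj S) (ρ i) = m' i)
    (hx : ∀ i, x.eval (Eff.nablaObj S) (ρ i) = x' i)
    (hy : ∀ i, y.eval (Eff.nablaObj S) (ρ i) = y' i) :
    Uniform (fun i => (isGlb le m x y).realizers (Eff.nablaObj S) (ρ i))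
      (fun i => m' i = x' i ⊓ y' i) := by
  have hw := h.wk (b := .base)
  refine (uniform_and (uniform_and (h.rel_of_eval hm hx) (h.rel_of_eval hm hy))
    (uniform_all (uniform_imp
      (uniform_and (hw.rel_of_eval (x := fun p : I × S => p.2) (fun _ => rfl) (eval_wk_of_eval hx))
        (hw.rel_of_eval (x := fun p : I × S => p.2) (fun _ => rfl) (eval_wk_of_eval hy)))
      (hw.rel_of_eval (x := fun p : I × S => p.2) (fun _ => rfl)
        (eval_wk_of_eval hm))))).congr fun i => ?_
  constructor
  · exact fun ⟨⟨h₁, h₂⟩, h₃⟩ => le_antisymm (le_inf h₁ h₂) (h₃ _ ⟨inf_le_left, inf_le_right⟩)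
  · intro e
    simp only [e]
    exact ⟨⟨inf_le_left, inf_le_right⟩, fun z hz => le_inf hz.1 hz.2⟩

theorem uniform_isLub_of_eval [Lattice S] (h : IsUniformRel ρ le (· ≤ ·)) {m x y : Tm Γ .base}
    {m' x' y' : I → S} (hm : ∀ i, m.eval (Eff.nablaObj S) (ρ i) = m' i)
    (hx : ∀ i, x.eval (Eff.nablaObj S) (ρ i) = x' i)
    (hy : ∀ i, y.eval (Eff.nablaObj S) (ρ i) = y' i) :
    Uniform (fun i => (isLub le m x y).realizers (Eff.nablaObj S) (ρ i))
      (fun i => m' i = x' i ⊔ y' i) := by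
  have hw := h.wk (b := .base)
  refine (uniform_and (uniform_and (h.rel_of_eval hx hm) (h.rel_of_eval hy hm))
    (uniform_all (uniform_imp
      (uniform_and (hw.rel_of_eval (y := fun p : I × S => p.2) (eval_wk_of_eval hx) (fun _ => rfl))
        (hw.rel_of_eval (y := fun p : I × S => p.2) (eval_wk_of_eval hy) (fun _ => rfl)))
      (hw.rel_of_eval (y := fun p : I × S => p.2) (eval_wk_of_eval hm)
        (fun _ => rfl))))).congr fun i => ?_
  constructor
  · exact fun ⟨⟨h₁, h₂⟩, h₃⟩ => le_antisymm (h₃ _ ⟨le_sup_left, le_sup_right⟩) (sup_le h₁ h₂)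
  · intro e
    simp only [e]
    exact ⟨⟨le_sup_left, le_sup_right⟩, fun z hz => sup_le hz.1 hz.2⟩

theorem uniform_isGlb [Lattice S] (h : IsUniformRel ρ le (· ≤ ·)) (m x y : Tm Γ .base) :
    Uniform (fun i => (isGlb le m x y).realizers (Eff.nablaObj S) (ρ i)) (fun i =>
      (show S from m.eval (Eff.nablaObj S) (ρ i)) =
        (show S from x.eval (Eff.nablaObj S) (ρ i)) ⊓ y.eval (Eff.nablaObj S) (ρ i)) :=
  uniform_isGlb_of_eval h (fun _ => rfl) (fun _ => rfl) (fun _ => rfl)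

theorem uniform_isLub [Lattice S] (h : IsUniformRel ρ le (· ≤ ·)) (m x y : Tm Γ .base) :
    Uniform (fun i => (isLub le m x y).realizers (Eff.nablaObj S) (ρ i)) (fun i =>
      (show S from m.eval (Eff.nablaObj S) (ρ i)) =
        (show S from x.eval (Eff.nablaObj S) (ρ i)) ⊔ y.eval (Eff.nablaObj S) (ρ i)) :=
  uniform_isLub_of_eval h (fun _ => rfl) (fun _ => rfl) (fun _ => rfl)

theorem uniform_isLattice [Lattice S] (h : IsUniformRel ρ le (· ≤ ·)) :
    Uniform (fun i => (isLattice le).realizers (Eff.nablaObj S) (ρ i)) (fun _ => True) := by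
  refine (uniform_and (uniform_isPoset h) (uniform_and
    (uniform_all (uniform_all (uniform_ex (uniform_isGlb h.wk.wk.wk v0 v2 v1))))
    (uniform_all (uniform_all (uniform_ex
      (uniform_isLub h.wk.wk.wk v0 v2 v1)))))).congr fun i => iff_true_intro ?_
  exact ⟨trivial, fun x y => ⟨(x ⊓ y : S), rfl⟩, fun x y => ⟨(x ⊔ y : S), rfl⟩⟩

theorem uniform_supDistrib [DistribLattice S] (h : IsUniformRel ρ le (· ≤ ·)) :
    Uniform (fun i => (supDistrib le).realizers (Eff.nablaObj S) (ρ i)) (fun _ => True) := by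
  have h' := (((((((h.wk (b := .base)).wk (b := .base)).wk (b := .base)).wk (b := .base)).wk
    (b := .base)).wk (b := .base)).wk (b := .base))
  refine (uniform_all (uniform_all (uniform_all (uniform_all (uniform_all (uniform_all
    (uniform_all (uniform_imp
      (uniform_and (uniform_and (uniform_isGlb h' v3 v6 v5) (uniform_isLub h' v2 v6 v4))
        (uniform_and (uniform_isLub h' v1 v5 v4) (uniform_isLub h' v0 v3 v4)))
      (uniform_isGlb h' v0 v2 v1))))))))).congr fun i => iff_true_intro ?_
  rintro (x y z p q r w : S) ⟨⟨hp, hq⟩, hr, hw⟩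
  have hp : p = x ⊓ y := hp
  have hq : q = x ⊔ z := hq
  have hr : r = y ⊔ z := hr
  have hw : w = p ⊔ z := hw
  show w = q ⊓ r
  rw [hw, hp, hq, hr, sup_inf_right]

theorem uniform_infDistrib [DistribLattice S] (h : IsUniformRel ρ le (· ≤ ·)) :
    Uniform (fun i => (infDistrib le).realizers (Eff.nablaObj S) (ρ i)) (fun _ => True) := by
  have h' := (((((((h.wk (b := .base)).wk (b := .base)).wk (b := .base)).wk (b := .base)).wk
    (b := .base)).wk (b := .base)).wk (b := .base))
  refine (uniform_all (uniform_all (uniform_all (uniform_all (uniform_all (uniform_all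
    (uniform_all (uniform_imp
      (uniform_and (uniform_and (uniform_isLub h' v3 v6 v5) (uniform_isGlb h' v2 v6 v4))
        (uniform_and (uniform_isGlb h' v1 v5 v4) (uniform_isGlb h' v0 v3 v4)))
      (uniform_isLub h' v0 v2 v1))))))))).congr fun i => iff_true_intro ?_
  rintro (x y z p q r w : S) ⟨⟨hp, hq⟩, hr, hw⟩
  have hp : p = x ⊔ y := hp
  have hq : q = x ⊓ z := hq
  have hr : r = y ⊓ z := hr
  have hw : w = p ⊓ z := hw
  show w = q ⊔ r
  rw [hw, hp, hq, hr, inf_sup_right]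

theorem uniform_isDistribLattice [DistribLattice S] (h : IsUniformRel ρ le (· ≤ ·)) :
    Uniform (fun i => (isDistribLattice le).realizers (Eff.nablaObj S) (ρ i)) (fun _ => True) :=
  (uniform_and (uniform_isLattice h) (uniform_and (uniform_supDistrib h)
    (uniform_infDistrib h))).congr fun _ => by simp

variable {f : Tm Γ (.pow (.prod .base .base))} {g : S → S}

theorem uniform_isFun (h : IsUniformRel ρ f (fun x y => g x = y)) :
    Uniform (fun i => (isFun f).realizers (Eff.nablaObj S) (ρ i)) (fun _ => True) := by
  refine (uniform_and (uniform_all (uniform_ex (h.wk.wk.rel v1 v0)))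
    (uniform_all (uniform_all (uniform_all (uniform_imp
      (uniform_and (h.wk.wk.wk.rel v2 v1) (h.wk.wk.wk.rel v2 v0))
      uniform_eq))))).congr
    fun i => iff_true_intro ?_
  exact ⟨fun x => ⟨g x, rfl⟩, fun x y z h => h.1.symm.trans h.2⟩

theorem uniform_isMonotone [Preorder S] (hle : IsUniformRel ρ le (· ≤ ·))
    (h : IsUniformRel ρ f (fun x y => g x = y)) :
    Uniform (fun i => (isMonotone le f).realizers (Eff.nablaObj S) (ρ i))
      (fun _ => Monotone g) := by
  refine (uniform_all (uniform_all (uniform_all (uniform_all (uniform_imp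
    (uniform_and (h.wk.wk.wk.wk.rel v3 v1) (h.wk.wk.wk.wk.rel v2 v0))
    (uniform_imp (hle.wk.wk.wk.wk.rel v3 v2) (hle.wk.wk.wk.wk.rel v1 v0))))))).congr fun i => ?_
  constructor
  · exact fun h x y hxy => h x y (g x) (g y) ⟨rfl, rfl⟩ hxy
  · rintro h (x y a b : S) ⟨ha, hb⟩ hxy
    have ha' : g x = a := ha
    have hb' : g y = b := hb
    have hab : a ≤ b := ha' ▸ hb' ▸ h hxy
    exact hab

theorem uniform_isProgressive [Preorder S] (hle : IsUniformRel ρ le (· ≤ ·))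
    (h : IsUniformRel ρ f (fun x y => g x = y)) :
    Uniform (fun i => (isProgressive le f).realizers (Eff.nablaObj S) (ρ i))
      (fun _ => ∀ x, x ≤ g x) := by
  refine (uniform_all (uniform_all (uniform_imp (h.wk.wk.rel v1 v0)
    (hle.wk.wk.rel v1 v0)))).congr fun i => ?_
  constructor
  · exact fun h x => h x (g x) rfl
  · rintro h (x y : S) hy
    have hy : g x = y := hy
    subst hy
    exact h x

theorem uniform_hasFixedPoint (h : IsUniformRel ρ f (fun x y => g x = y)) :
    Uniform (fun i => (hasFixedPoint f).realizers (Eff.nablaObj S) (ρ i))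
      (fun _ => ∃ x, g x = x) :=
  uniform_ex (h.wk.rel v0 v0)

theorem uniform_fixedPoint_above [LE S] (hle : IsUniformRel ρ le (· ≤ ·))
    (h : IsUniformRel ρ f (fun x y => g x = y)) :
    Uniform (fun i => ((rel le.wk.wk v1 v0).and (isFixedPoint f.wk.wk v0)).ex.all.realizers
      (Eff.nablaObj S) (ρ i)) (fun _ => ∀ x, ∃ y, x ≤ y ∧ g y = y) :=
  uniform_all (uniform_ex (uniform_and (hle.wk.wk.rel v1 v0) (h.wk.wk.rel v0 v0)))

/-- The elements `x` of `∇S` for which the formula `x ∈ A` is realized. -/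
def support (A : S → Set ℕ) : Set S :=
  {x | (rand ((Eff.nablaObj S).ex x) (rand ((Eff.nablaObj S).pow.ex A) (A x))).Nonempty}

/-- Membership in `A` need not be uniform here, as it is only a hypothesis of the formula. -/
theorem uniform_bound [LE S] (h : IsUniformRel ρ le (· ≤ ·)) {x : Tm Γ .base}
    {A : Tm Γ (.pow .base)} {x' : I → S} {A' : I → S → Set ℕ}
    (hx : ∀ i, x.eval (Eff.nablaObj S) (ρ i) = x' i)
    (hA : ∀ i, A.eval (Eff.nablaObj S) (ρ i) = A' i) :
    Uniform (fun i => (bound le x A).realizers (Eff.nablaObj S) (ρ i))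
      (fun i => x' i ∈ upperBounds (support (A' i))) := by
  have hw := h.wk (b := .base)
  refine (uniform_all (Uniform.imp (A := fun p : I × S => (Tm.mem v0 A.wk).realizers
    (Eff.nablaObj S) (Env.cons (b := .base) p.2 (ρ p.1))) (hw.rel_of_eval
      (x := fun p : I × S => p.2) (fun _ => rfl) (eval_wk_of_eval hx)))).congr fun i => ?_
  refine forall_congr' fun u => imp_congr ?_ Iff.rfl
  have e := eval_wk_of_eval (b := .base) hA (i, u)
  change _ ↔ (rand _ (rand _ _)).Nonempty
  rw [← e]
  rfl

theorem uniform_isSup [LE S] (h : IsUniformRel ρ le (· ≤ ·)) {z : Tm Γ .base}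
    {A : Tm Γ (.pow .base)} {z' : I → S} {A' : I → S → Set ℕ}
    (hz : ∀ i, z.eval (Eff.nablaObj S) (ρ i) = z' i)
    (hA : ∀ i, A.eval (Eff.nablaObj S) (ρ i) = A' i) :
    Uniform (fun i => (isSup le z A).realizers (Eff.nablaObj S) (ρ i))
      (fun i => z' i ∈ upperBounds (support (A' i)) ∧
        z' i ∈ lowerBounds (upperBounds (support (A' i)))) :=
  have hw := h.wk (b := .base)
  uniform_and (uniform_bound h hz hA) (uniform_all (uniform_imp
    (uniform_bound hw (x' := fun p : I × S => p.2) (fun _ => rfl) (eval_wk_of_eval hA))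
    (hw.rel_of_eval (y := fun p : I × S => p.2) (eval_wk_of_eval hz) (fun _ => rfl))))

end Order

end HOL

namespace Realizability

/-! ### Chains in constant objects -/

/-- A program that realizes a family of implications sends a common realizer of the hypotheses to a
common realizer of the conclusions. -/
theorem exists_forall_mem_of_iInter_rimp {J : Type} [Nonempty J] {A B : J → Set ℕ} {n m : ℕ}
    (hn : n ∈ ⋂ j, rimp (A j) (B j)) (hm : ∀ j, m ∈ A j) : ∃ k, ∀ j, k ∈ B j := by
  obtain ⟨j₀⟩ := ‹Nonempty J›
  obtain ⟨k, hk, -⟩ := Set.mem_iInter.1 hn j₀ m (hm j₀)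
  refine ⟨k, fun j => ?_⟩
  obtain ⟨l, hl, hl'⟩ := Set.mem_iInter.1 hn j m (hm j)
  exact Part.mem_unique hl hk ▸ hl'

/-- If one program decides `x ≤ y ∨ y ≤ x` from realizers of `x, y ∈ C`, then elements with a
common realizer are equal: fed with the same realizer twice, the program gives the same answer for
`x, y` and for `y, x`. So there are at most countably many elements. -/
theorem countable_of_realized_total {S : Type} [PartialOrder S] {M : S → Set ℕ}
    {L : S → S → Set ℕ} (hL : ∀ x y, (L x y).Nonempty → x ≤ y) {q : ℕ}
    (hq : ∀ x y, q ∈ rimp (rand (M x) (M y)) (ror (L x y) (L y x))) :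
    {x | (M x).Nonempty}.Countable := by
  have hinj : ∀ x y m, m ∈ M x → m ∈ M y → x = y := by
    intro x y m hx hy
    obtain ⟨k, hk, hk'⟩ := hq x y _ ⟨m, hx, m, hy, rfl⟩
    obtain ⟨l, hl, hl'⟩ := hq y x _ ⟨m, hy, m, hx, rfl⟩
    obtain rfl := Part.mem_unique hl hk
    rcases hk' with ⟨a, ha, rfl⟩ | ⟨a, ha, rfl⟩ <;> rcases hl' with ⟨b, hb, e⟩ | ⟨b, hb, e⟩
    · exact le_antisymm (hL _ _ ⟨a, ha⟩) (hL _ _ ⟨b, hb⟩)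
    · exact absurd (Nat.pair_eq_pair.1 e).1 zero_ne_one
    · exact absurd (Nat.pair_eq_pair.1 e).1 one_ne_zero
    · exact le_antisymm (hL _ _ ⟨b, hb⟩) (hL _ _ ⟨a, ha⟩)
  refine Set.countable_iff_exists_injective.2 ⟨fun x => x.2.choose, fun x y h => ?_⟩
  have h' : x.2.choose = y.2.choose := h
  exact Subtype.ext (hinj _ _ _ x.2.choose_spec (h' ▸ y.2.choose_spec))

end Realizability

namespace HOL

section ChainComplete

variable {S : Type} {Γ : Ctx} {I : Type} {ρ : I → Env (Eff.nablaObj S) Γ}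
  {le : Tm Γ (.pow (.prod .base .base))}

/-- Internal chains of a constant poset have at most countably many elements. -/
theorem countable_support_of_isChain [PartialOrder S] (h : IsUniformRel ρ le (· ≤ ·))
    {C : Tm Γ (.pow .base)} {C' : I → S → Set ℕ}
    (hC : ∀ i, C.eval (Eff.nablaObj S) (ρ i) = C' i) {i : I}
    (hi : ((isChain le C).realizers (Eff.nablaObj S) (ρ i)).Nonempty) :
    (support (C' i)).Countable := by
  rcases isEmpty_or_nonempty S with hS | hS
  · exact Set.to_countable _
  obtain ⟨n, hn⟩ := hi
  obtain ⟨A, hA, hQ⟩ := h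
  let M : S → Set ℕ := fun x => rand ((Eff.nablaObj S).ex x)
    (rand ((Eff.nablaObj S).pow.ex (C' i)) (C' i x))
  let L : S → S → Set ℕ := fun x y => rand (((Eff.nablaObj S).prod (Eff.nablaObj S)).ex (x, y))
    (rand (((Eff.nablaObj S).prod (Eff.nablaObj S)).pow.ex A) (A (x, y)))
  have e : ∀ p : S × S, Tm.realizers (Eff.nablaObj S) (((Tm.mem v1 C.wk.wk).and
      (Tm.mem v0 C.wk.wk)).imp ((rel le.wk.wk v1 v0).or (rel le.wk.wk v0 v1)))
      (Env.cons (b := .base) p.2 (Env.cons (b := .base) p.1 (ρ i))) =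
      rimp (rand (M p.1) (M p.2)) (ror (L p.1 p.2) (L p.2 p.1)) := by
    rintro ⟨x, y⟩
    have eC := eval_wk_of_eval (b := .base) (eval_wk_of_eval (b := .base) hC) ((i, x), y)
    have eA := eval_wk_of_eval (b := .base) (eval_wk_of_eval (b := .base) hA) ((i, x), y)
    simp only [M, L]
    rw [← eC, ← eA]
    rfl
  -- Every number realizes the existence of every element, so `0` instantiates both quantifiers.
  obtain ⟨q', hq'⟩ := exists_forall_mem_of_iInter_rimp (J := S) (m := 0) hn fun _ => rfl
  obtain ⟨q, hq⟩ := exists_forall_mem_of_iInter_rimp (J := S × S) (n := q') (m := 0)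
    (A := fun _ => Set.univ)
    (B := fun p => rimp (rand (M p.1) (M p.2)) (ror (L p.1 p.2) (L p.2 p.1)))
    (Set.mem_iInter.2 fun p m _ => by
      rw [← e p]
      exact Set.mem_iInter.1 (hq' p.1) p.2 m rfl)
    fun _ => trivial
  exact countable_of_realized_total (M := M) (L := L)
    (fun x y ⟨_, _, _, _, ⟨_, _, a, ha, _⟩, _⟩ => hQ.1 (x, y) ⟨a, ha⟩) fun x y => hq (x, y)

/-- The internal supremum of a chain is the supremum of its support, which exists as the support is
countable; being a supremum is uniform, so no program has to find it. -/
theorem uniform_isChainComplete [PartialOrder S] (h : IsUniformRel ρ le (· ≤ ·))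
    (hS : ∀ s : Set S, s.Countable → ∃ z, IsLUB s z) :
    Uniform (fun i => (isChainComplete le).realizers (Eff.nablaObj S) (ρ i)) (fun _ => True) := by
  have hw := h.wk (b := .pow .base)
  have hsup := uniform_ex (S := S)
    (ρ := fun p : I × (S → Set ℕ) => Env.cons (b := .pow .base) p.2 (ρ p.1))
    (uniform_isSup (hw.wk (b := .base)) (z := v0) (A := v1) (fun _ => rfl) (fun _ => rfl))
  refine Uniform.congr (Uniform.iInter_imp (D := fun _ A => (Eff.nablaObj S).pow.ex A)
    (Uniform.imp hsup)) fun i => iff_true_intro fun A _ hA => ?_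
  exact hS _ (countable_support_of_isChain hw (C := v0) (C' := fun p => p.2) (fun _ => rfl) hA)

end ChainComplete

end HOL

namespace Eff

/-! ### Countable ordinals -/

theorem Omega1.exists_isLUB {s : Set Omega1} (hs : s.Countable) : ∃ z, IsLUB s z := by
  have := hs.to_subtype
  let f : s → Ordinal := fun x => (Ordinal.ToType.mk.symm x.1).1
  have hf : ⨆ x, f x < Ordinal.omega 1 :=
    Ordinal.iSup_lt_omega_one fun x => (Ordinal.ToType.mk.symm x.1).2
  have hne : (upperBounds s).Nonempty := by
    refine ⟨Ordinal.ToType.mk ⟨⨆ x, f x, hf⟩, fun x hx => ?_⟩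
    rw [← Ordinal.ToType.mk.symm_apply_le]
    exact Ordinal.le_iSup f ⟨x, hx⟩
  exact ⟨wellFounded_lt.min _ hne, wellFounded_lt.min_mem _ hne,
    fun w hw => not_lt.1 (wellFounded_lt.not_lt_min _ hw)⟩

theorem Omega1.noMaxOrder : NoMaxOrder Omega1 :=
  Ordinal.isSuccPrelimit_type_lt_iff.1
    (by rw [Ordinal.type_toType]; exact (Cardinal.isSuccLimit_omega 1).isSuccPrelimit)

theorem Omega1.succ_ne (x : Omega1) : Order.succ x ≠ x :=
  have := Omega1.noMaxOrder
  (Order.lt_succ x).ne'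

/-- Every functional relation that represents `∇succ` is uniform. -/
theorem uniform_of_toHom_eq_nablaSucc
    {F : FunRel (nabla.obj Omega1) (nabla.obj Omega1)} (hF : F.toHom = nablaSucc) :
    Uniform (fun p : Omega1 × Omega1 => F.rel p.1 p.2) (fun p => Order.succ p.1 = p.2) := by
  have h : F ≈ nablaRel Order.succ := Quotient.exact hF
  exact Uniform.of_ent h.1 h.2

end Eff

namespace HOL

/-! ### Failure of the fixed point theorems for `∇ω₁` -/

/-- The environment given by the order of `∇ω₁` and a relation that represents an endomap. -/
abbrev omegaEnv (F : Eff.Omega1 × Eff.Omega1 → Set ℕ) : Env (Eff.nabla.obj Eff.Omega1) orderCtx :=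
  Env.cons (b := .pow (.prod .base .base)) F
    (Env.cons (b := .pow (.prod .base .base)) (Eff.nablaLe Eff.Omega1).pred (Env.nil _))

theorem isUniformRel_omegaEnv_le (F : Eff.Omega1 × Eff.Omega1 → Set ℕ) :
    IsUniformRel (fun _ : Unit => omegaEnv F) v1 (fun x y : Eff.Omega1 => x ≤ y) :=
  ⟨_, fun _ => rfl, Uniform.prop _⟩

theorem isUniformRel_omegaEnv_map {F : Eff.Omega1 × Eff.Omega1 → Set ℕ}
    {g : Eff.Omega1 → Eff.Omega1} (h : Uniform F (fun p => g p.1 = p.2)) :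
    IsUniformRel (fun _ : Unit => omegaEnv F) v0 (fun x y : Eff.Omega1 => g x = y) :=
  ⟨_, fun _ => rfl, h⟩

/-- To establish that a formula holds for `∇ω₁` and `∇succ` it suffices to show that it is uniform
and true. -/
theorem holds_of_uniform {φ : Fm orderCtx} {P : Prop} (hP : P)
    (h : ∀ F : Eff.Omega1 × Eff.Omega1 → Set ℕ, Uniform F (fun p => Order.succ p.1 = p.2) →
      Uniform (fun _ : Unit => φ.realizers (Eff.nablaObj Eff.Omega1) (omegaEnv F)) (fun _ => P)) :
    Holds (Eff.nabla.obj Eff.Omega1) (Eff.nablaLe Eff.Omega1) Eff.nablaSucc φ :=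
  fun _ hF => (h _ (Eff.uniform_of_toHom_eq_nablaSucc hF)).nonempty (i := ()) hP

theorem holds_isDistribLattice :
    Holds (Eff.nabla.obj Eff.Omega1) (Eff.nablaLe Eff.Omega1) Eff.nablaSucc
      (isDistribLattice v1) :=
  holds_of_uniform trivial fun F _ => uniform_isDistribLattice (isUniformRel_omegaEnv_le F)

theorem holds_isChainComplete :
    Holds (Eff.nabla.obj Eff.Omega1) (Eff.nablaLe Eff.Omega1) Eff.nablaSucc
      (isChainComplete v1) :=
  holds_of_uniform trivial fun F _ =>
    uniform_isChainComplete (isUniformRel_omegaEnv_le F) fun _ => Eff.Omega1.exists_isLUB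

theorem holds_isFun :
    Holds (Eff.nabla.obj Eff.Omega1) (Eff.nablaLe Eff.Omega1) Eff.nablaSucc (isFun v0) :=
  holds_of_uniform trivial fun _ hF => uniform_isFun (isUniformRel_omegaEnv_map hF)

theorem holds_isMonotone :
    Holds (Eff.nabla.obj Eff.Omega1) (Eff.nablaLe Eff.Omega1) Eff.nablaSucc
      (isMonotone v1 v0) :=
  holds_of_uniform Order.succ_mono fun F hF =>
    uniform_isMonotone (isUniformRel_omegaEnv_le F) (isUniformRel_omegaEnv_map hF)

theorem holds_isProgressive :
    Holds (Eff.nabla.obj Eff.Omega1) (Eff.nablaLe Eff.Omega1) Eff.nablaSucc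
      (isProgressive v1 v0) :=
  holds_of_uniform Order.le_succ fun F hF =>
    uniform_isProgressive (isUniformRel_omegaEnv_le F) (isUniformRel_omegaEnv_map hF)

theorem holds_not_hasFixedPoint :
    Holds (Eff.nabla.obj Eff.Omega1) (Eff.nablaLe Eff.Omega1) Eff.nablaSucc
      (hasFixedPoint v0).neg :=
  holds_of_uniform (P := ¬ ∃ x : Eff.Omega1, Order.succ x = x)
    (fun ⟨x, hx⟩ => Eff.Omega1.succ_ne x hx) fun _ hF =>
    uniform_imp (uniform_hasFixedPoint (isUniformRel_omegaEnv_map hF)) Uniform.bot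

theorem nonempty_all_elim {X : Eff} {Γ : Ctx} {b : Ty} {φ : Fm (b :: Γ)} {ρ : Env X Γ}
    (h : (φ.all.realizers X ρ).Nonempty) (u : (b.interp X).carrier)
    (hu : ((b.interp X).ex u).Nonempty) : (φ.realizers X (Env.cons u ρ)).Nonempty :=
  nonempty_of_rimp (h.mono (Set.iInter_subset _ u)) hu

/-- A statement about all orders and endomaps of the ground type, if valid, holds for `∇ω₁` and
`∇succ`. -/
theorem nonempty_of_validIn {φ : Fm orderCtx}
    (h : ValidIn (Eff.nabla.obj Eff.Omega1)
      (Tm.all (a := .pow (.prod .base .base)) (Tm.all (a := .pow (.prod .base .base)) φ))) :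
    (φ.realizers (Eff.nabla.obj Eff.Omega1)
      (omegaEnv fun p => (Eff.nablaRel (S := Eff.Omega1) Order.succ).rel p.1 p.2)).Nonempty :=
  nonempty_all_elim (nonempty_all_elim (X := Eff.nabla.obj Eff.Omega1) h _
    (nabla_pow_ex_nonempty (S := Eff.Omega1) (T := Eff.Omega1) _)) _
    (nabla_pow_ex_nonempty (S := Eff.Omega1) (T := Eff.Omega1) _)

theorem not_validIn_tarski : ¬ ValidIn (Eff.nabla.obj Eff.Omega1) tarski := fun h => by
  have hlat := uniform_isLattice
    (isUniformRel_omegaEnv_le fun p => (Eff.nablaRel (S := Eff.Omega1) Order.succ).rel p.1 p.2)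
  have hfix := nonempty_of_rimp (nonempty_of_validIn h) (nonempty_rand
    (nonempty_rand (hlat.nonempty (i := ()) trivial) (holds_isChainComplete _ rfl))
    (nonempty_rand (holds_isFun _ rfl) (holds_isMonotone _ rfl)))
  obtain ⟨k, hk⟩ := nonempty_of_rimp (holds_not_hasFixedPoint _ rfl) hfix
  exact hk

theorem not_validIn_bourbakiWitt : ¬ ValidIn (Eff.nabla.obj Eff.Omega1) bourbakiWitt := fun h => by
  let F := fun p : Eff.Omega1 × Eff.Omega1 =>
    (Eff.nablaRel (S := Eff.Omega1) Order.succ).rel p.1 p.2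
  have hfix := nonempty_of_rimp (nonempty_of_validIn h) (nonempty_rand
    (nonempty_rand ((uniform_isPoset (isUniformRel_omegaEnv_le F)).nonempty (i := ()) trivial)
      (holds_isChainComplete _ rfl))
    (nonempty_rand (holds_isFun _ rfl) (holds_isProgressive _ rfl)))
  have hu := uniform_fixedPoint_above (isUniformRel_omegaEnv_le F)
    (isUniformRel_omegaEnv_map (g := Order.succ) (Uniform.prop _))
  obtain ⟨x, -⟩ := Eff.Omega1.exists_isLUB Set.countable_empty
  obtain ⟨y, -, hy⟩ := hu.1 () hfix x
  exact Eff.Omega1.succ_ne y hy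

theorem not_provable_of_not_validIn {φ : Sentence} {X : Eff} (h : ¬ ValidIn X φ) :
    ¬ Provable DC φ := fun d => by
  refine h (validIn_of_ent (d.sound ?_ (Ent.top _) (by simp)))
  rintro _ ⟨a, rfl⟩
  exact dependentChoice_valid X a

end HOL

theorem mainTheorem1 :
    -- In the effective topos, `∇ω₁` is a chain-complete distributive lattice and `∇succ` is a
    -- monotone and progressive endomap of it without a fixed point.
    (HOL.Holds (Eff.nabla.obj Eff.Omega1) (Eff.nablaLe Eff.Omega1) Eff.nablaSucc
        (HOL.isDistribLattice HOL.v1) ∧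
      HOL.Holds (Eff.nabla.obj Eff.Omega1) (Eff.nablaLe Eff.Omega1) Eff.nablaSucc
        (HOL.isChainComplete HOL.v1) ∧
      HOL.Holds (Eff.nabla.obj Eff.Omega1) (Eff.nablaLe Eff.Omega1) Eff.nablaSucc
        (HOL.isMonotone HOL.v1 HOL.v0) ∧
      HOL.Holds (Eff.nabla.obj Eff.Omega1) (Eff.nablaLe Eff.Omega1) Eff.nablaSucc
        (HOL.isProgressive HOL.v1 HOL.v0) ∧
      HOL.Holds (Eff.nabla.obj Eff.Omega1) (Eff.nablaLe Eff.Omega1) Eff.nablaSucc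
        (HOL.hasFixedPoint HOL.v0).neg) ∧
    -- Dependent Choice is valid in the effective topos, whereas Tarski's theorem for chain-complete
    -- lattices and the Bourbaki-Witt theorem are not.
    (∀ X : Eff, ∀ φ ∈ HOL.DC, HOL.ValidIn X φ) ∧
    ¬ HOL.ValidIn (Eff.nabla.obj Eff.Omega1) HOL.tarski ∧
    ¬ HOL.ValidIn (Eff.nabla.obj Eff.Omega1) HOL.bourbakiWitt ∧
    -- Neither theorem is provable in higher-order intuitionistic logic with Dependent Choice.
    ¬ HOL.Provable HOL.DC HOL.tarski ∧
    ¬ HOL.Provable HOL.DC HOL.bourbakiWitt :=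
  ⟨⟨HOL.holds_isDistribLattice, HOL.holds_isChainComplete, HOL.holds_isMonotone,
      HOL.holds_isProgressive, HOL.holds_not_hasFixedPoint⟩,
    fun X _ ⟨a, h⟩ => h ▸ HOL.dependentChoice_valid X a,
    HOL.not_validIn_tarski, HOL.not_validIn_bourbakiWitt,
    HOL.not_provable_of_not_validIn HOL.not_validIn_tarski,
    HOL.not_provable_of_not_validIn HOL.not_validIn_bourbakiWitt⟩
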